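/- Let $R$ and $S$ be associative unital rings; modules are unitary, and right modules are regarded as left modules over the opposite ring. A left module over a ring is *super finitely presented* if it has a projective resolution consisting of finitely generated projective modules. A left $S$-module $I$ is *weak injective* if $\operatorname{Ext}^1_S(N,I)=0$ for every super finitely presented left $S$-module $N$; a left $R$-module $F$ is *weak flat* if $\operatorname{Tor}_1^R(N,F)=0$ for every super finitely presented right $R$-module $N$. An $(S,R)$-bimodule $C={}_SC_R$ is *semidualizing* if $C$ is super finitely presented both as a left $S$-module and as a right $R$-module, the homothety maps $S\to\operatorname{Hom}_{R^{op}}(C,C)$ and $R\to\operatorname{Hom}_S(C,C)$ are bijective, and $\operatorname{Ext}^i_S(C,C)=0=\operatorname{Ext}^i_{R^{op}}(C,C)$ for all $i\ge 1$. It is *faithfully semidualizing* if moreover, for every left $S$-module $N$ and every right $R$-module $M$, $\operatorname{Hom}_S(C,N)=0$ implies $N=0$ and $\operatorname{Hom}_{R^{op}}(C,M)=0$ implies $M=0$. **Proposition 2.8.** Let ${}_SC_R$ be a faithfully semidualizing bimodule. Let $\mathcal{WF}_C(S)$ be the class of left $S$-modules isomorphic to $C\otimes_R F$ for some weak flat left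 $R$-module $F$, and let $\mathcal{WI}_C(R)$ be the class of left $R$-modules isomorphic to $\operatorname{Hom}_S(C,I)$ for some weak injective left $S$-module $I$. Then each of the classes $\mathcal{WF}_C(S)$ and $\mathcal{WI}_C(R)$ is closed under direct summands, arbitrary direct products, arbitrary direct sums, and direct limits (of direct systems of modules in the class indexed by nonempty directed sets). -/

import Mathlib

open CategoryTheory MulOpposite
open scoped TensorProduct DirectSum

universe u

namespace CWeak

noncomputable section

/-! Throughout, `R` and `S` are associative unital rings. Right `R`-modules are left modules over
`Rᵐᵒᵖ`, so that `x r` is written `op r • x`. -/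

section Tensor

/-! ### Tensor products over a noncommutative ring -/

variable (S R : Type*) [Ring S] [Ring R]
variable (C : Type*) [AddCommGroup C] [Module S C] [Module Rᵐᵒᵖ C]
variable (F : Type*) [AddCommGroup F] [Module R F]

/-- The relations `(c r) ⊗ x = c ⊗ (r x)`. For an `(S, R)`-bimodule `C` the set of generators is
stable under `S`, so that the `S`-submodule spanned by it is the additive subgroup it generates. -/
def balancedRel : Submodule S (C ⊗[ℤ] F) :=
  Submodule.span S {t | ∃ (c : C) (r : R) (x : F), t = (op r • c) ⊗ₜ[ℤ] x - c ⊗ₜ[ℤ] (r • x)}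

/-- The left `S`-module `C ⊗_R F`, for an `(S, R)`-bimodule `C` and a left `R`-module `F`.
For a right `R`-module `C` take `S = ℤ`. -/
abbrev BalTensor : Type _ := (C ⊗[ℤ] F) ⧸ balancedRel S R C F

end Tensor

section TensorFunctor

variable (R : Type u) [Ring R] (F : Type u) [AddCommGroup F] [Module R F]

variable {R} in
/-- The map `f ⊗_R F : N ⊗_R F → N' ⊗_R F` induced by a map `f : N → N'` of right `R`-modules. -/
def balTensorMap {N N' : Type u} [AddCommGroup N] [Module Rᵐᵒᵖ N]
    [AddCommGroup N'] [Module Rᵐᵒᵖ N'] (f : N →ₗ[Rᵐᵒᵖ] N') :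
    BalTensor ℤ R N F →ₗ[ℤ] BalTensor ℤ R N' F :=
  Submodule.mapQ _ _ (TensorProduct.map f.toAddMonoidHom.toIntLinearMap LinearMap.id) <| by
    refine Submodule.span_le.2 ?_
    rintro _ ⟨c, r, x, rfl⟩
    refine Submodule.subset_span ⟨f c, r, x, ?_⟩
    simp

variable {R} in
theorem balTensor_hom_ext {N : Type u} [AddCommGroup N] [Module Rᵐᵒᵖ N]
    {Z : Type u} [AddCommGroup Z] {f g : BalTensor ℤ R N F →ₗ[ℤ] Z}
    (h : ∀ (c : N) (x : F), f ((balancedRel ℤ R N F).mkQ (c ⊗ₜ[ℤ] x)) =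
      g ((balancedRel ℤ R N F).mkQ (c ⊗ₜ[ℤ] x))) : f = g :=
  Submodule.linearMap_qext _ (TensorProduct.ext' h)

/-- The functor `- ⊗_R F` from right `R`-modules to abelian groups. -/
def tensorFunctor : ModuleCat.{u} Rᵐᵒᵖ ⥤ ModuleCat.{u} ℤ where
  obj N := ModuleCat.of ℤ (BalTensor ℤ R N F)
  map f := ModuleCat.ofHom (balTensorMap F f.hom)
  map_id _ := ModuleCat.hom_ext (balTensor_hom_ext F fun _ _ => rfl)
  map_comp _ _ := ModuleCat.hom_ext (balTensor_hom_ext F fun _ _ => rfl)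

instance : (tensorFunctor R F).Additive where
  map_add {_ _ f g} := ModuleCat.hom_ext <| balTensor_hom_ext F fun c x =>
    congrArg (balancedRel ℤ R _ F).mkQ (TensorProduct.add_tmul (f.hom c) (g.hom c) x)

/-- `Tor_n^R(N, F)` for a right `R`-module `N` and a left `R`-module `F`: the `n`-th left derived
functor of `- ⊗_R F` at `N`. -/
def TorGroup (N : ModuleCat.{u} Rᵐᵒᵖ) (n : ℕ) : ModuleCat.{u} ℤ :=
  ((tensorFunctor R F).leftDerived n).obj N

end TensorFunctor

section Classes

variable (A : Type u) [Ring A]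

/-- A left `A`-module is super finitely presented if it has a projective resolution by finitely
generated projective modules. -/
def SuperFinitelyPresented (M : ModuleCat.{u} A) : Prop :=
  ∃ P : ProjectiveResolution M, ∀ n, Module.Finite A (P.complex.X n)

/-- `M` is weak injective if `Ext¹_A(F, M) = 0` for all super finitely presented `F`. -/
def WeakInjective (M : ModuleCat.{u} A) : Prop :=
  ∀ F : ModuleCat.{u} A, SuperFinitelyPresented A F → Subsingleton (Abelian.Ext.{u} F M 1)

/-- The left module `M` is weak flat if `Tor₁^A(N, M) = 0` for all super finitely presented right
modules `N`. -/
def WeakFlat (M : ModuleCat.{u} A) : Prop :=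
  ∀ N : ModuleCat.{u} Aᵐᵒᵖ, SuperFinitelyPresented Aᵐᵒᵖ N → Subsingleton (TorGroup A M N 1)

variable {A} (P : ModuleCat.{u} A → Prop)

/-- A class of modules is closed under direct summands. -/
def ClosedUnderSummands : Prop :=
  ∀ M X Y : ModuleCat.{u} A, Nonempty (M ≃ₗ[A] (X × Y)) → P M → P X

/-- A class of modules is closed under direct products. -/
def ClosedUnderProducts : Prop :=
  ∀ (ι : Type u) (M : ι → ModuleCat.{u} A), (∀ i, P (M i)) → P (ModuleCat.of A (∀ i, M i))

/-- A class of modules is closed under direct sums. -/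
def ClosedUnderDirectSums : Prop :=
  ∀ (ι : Type u) (M : ι → ModuleCat.{u} A), (∀ i, P (M i)) → P (ModuleCat.of A (⨁ i, M i))

open Classical in
/-- A class of modules is closed under direct limits, that is, colimits of direct systems indexed
by directed (pre)ordered sets. -/
def ClosedUnderDirectLimits : Prop :=
  ∀ (ι : Type u) [Preorder ι] [Nonempty ι] [IsDirectedOrder ι] (M : ι → ModuleCat.{u} A)
    (f : ∀ i j, i ≤ j → M i →ₗ[A] M j) [DirectedSystem (fun i => M i) (fun i j h => f i j h)],
    (∀ i, P (M i)) → P (ModuleCat.of A (Module.DirectLimit (fun i => M i) f))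

end Classes

section Semidualizing

variable (S R : Type u) [Ring S] [Ring R]
variable (C : Type u) [AddCommGroup C] [Module S C] [Module Rᵐᵒᵖ C] [SMulCommClass S Rᵐᵒᵖ C]

/-- Left multiplication `c ↦ s c` on an `(S, R)`-bimodule, as a map of right `R`-modules. -/
def leftMul (s : S) : C →ₗ[Rᵐᵒᵖ] C where
  toFun c := s • c
  map_add' := smul_add s
  map_smul' r c := smul_comm s r c

/-- Right multiplication `c ↦ c r` on an `(S, R)`-bimodule, as a map of left `S`-modules. -/
def rightMul (r : R) : C →ₗ[S] C where
  toFun c := op r • c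
  map_add' := smul_add (op r)
  map_smul' s c := (smul_comm s (op r) c).symm

/-- The `(S, R)`-bimodule `C` is semidualizing. -/
structure Semidualizing : Prop where
  a1 : SuperFinitelyPresented S (ModuleCat.of S C)
  a2 : SuperFinitelyPresented Rᵐᵒᵖ (ModuleCat.of Rᵐᵒᵖ C)
  /-- the homothety map `s ↦ (c ↦ s c)` from `S` to `Hom_{Rᵒᵖ}(C, C)` is bijective -/
  b1 : Function.Bijective (leftMul S R C)
  /-- the homothety map `r ↦ (c ↦ c r)` from `R` to `Hom_S(C, C)` is bijective -/
  b2 : Function.Bijective (rightMul S R C)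
  c1 : ∀ i : ℕ, 1 ≤ i →
    Subsingleton (Abelian.Ext.{u} (ModuleCat.of S C) (ModuleCat.of S C) i)
  c2 : ∀ i : ℕ, 1 ≤ i →
    Subsingleton (Abelian.Ext.{u} (ModuleCat.of Rᵐᵒᵖ C) (ModuleCat.of Rᵐᵒᵖ C) i)

/-- The `(S, R)`-bimodule `C` is faithfully semidualizing: it is semidualizing, and `Hom_S(C, N)`
and `Hom_{Rᵒᵖ}(C, M)` vanish only if the modules `N` and `M` vanish. -/
structure FaithfullySemidualizing : Prop extends Semidualizing S R C where
  faithful_left : ∀ N : ModuleCat.{u} S, Subsingleton (C →ₗ[S] N) → Subsingleton N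
  faithful_right : ∀ M : ModuleCat.{u} Rᵐᵒᵖ, Subsingleton (C →ₗ[Rᵐᵒᵖ] M) → Subsingleton M

variable (I : Type u) [AddCommGroup I] [Module S I]

/-- The group `Hom_S(C, I)`, to be regarded as a left `R`-module. -/
def BimodHom (_R : Type u) : Type u := C →ₗ[S] I

instance : AddCommGroup (BimodHom S C I R) := inferInstanceAs (AddCommGroup (C →ₗ[S] I))

/-- The left `R`-module structure of `Hom_S(C, I)`: `(r f)(c) = f (c r)`. -/
instance : Module R (BimodHom S C I R) where
  smul r := fun (f : C →ₗ[S] I) => f.comp (rightMul S R C r)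
  one_smul := fun (f : C →ₗ[S] I) => LinearMap.ext fun c => congrArg f (one_smul Rᵐᵒᵖ c)
  mul_smul r r' := fun (f : C →ₗ[S] I) => LinearMap.ext fun c =>
    congrArg f (mul_smul (op r') (op r) c)
  smul_zero _ := rfl
  smul_add _ _ _ := rfl
  add_smul r r' := fun (f : C →ₗ[S] I) => LinearMap.ext fun c =>
    (congrArg f (add_smul (op r) (op r') c)).trans (f.map_add _ _)
  zero_smul := fun (f : C →ₗ[S] I) => LinearMap.ext fun c =>
    (congrArg f (zero_smul Rᵐᵒᵖ c)).trans f.map_zero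

/-- The class `WF_C(S)` of `C`-weak flat left `S`-modules: those of the form `C ⊗_R F` with `F` a
weak flat left `R`-module. -/
def WFC (V : ModuleCat.{u} S) : Prop :=
  ∃ F : ModuleCat.{u} R, WeakFlat R F ∧ Nonempty (V ≃ₗ[S] BalTensor S R C F)

/-- The class `WI_C(R)` of `C`-weak injective left `R`-modules: those of the form `Hom_S(C, I)`
with `I` a weak injective left `S`-module. -/
def WIC (U : ModuleCat.{u} R) : Prop :=
  ∃ I : ModuleCat.{u} S, WeakInjective S I ∧ Nonempty (U ≃ₗ[R] BimodHom S C I R)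

end Semidualizing

end

end CWeak

/-! Weak injectivity and weak flatness are finitary conditions. Super finitely presented modules
have resolutions by finitely generated free modules, so the vanishing of Ext¹ or Tor₁ says that
certain sequences of matrices over the ring, acting on columns of module elements, are exact
(`weakInjective_iff`, `weakFlat_iff`). Conditions of this kind (`MatrixDefinable`) pass to retracts,
products, direct sums and direct limits.

It remains to carry this along the adjoint functors C ⊗_R - and Hom_S(C, -). Mapping a finite
presentation of the right module C into C gives an exact sequence 0 → S → Cⁿ → Cᵐ, because S is the
ring of R^op-endomorphisms of C. Its terms are super finitely presented over S, hence so are the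
cokernels that occur, and Hom_S(-, I) keeps it exact when I is weak injective: Hom_S(C, I)ᵐ →
Hom_S(C, I)ⁿ → I → 0 (`WeakInjective.evaluation_exact`). The cokernel of the first map is also C ⊗_R
Hom_S(C, I), so evaluation is bijective (`bijective_evalMap`). The character module of a weak flat
module F is weak injective, and the same argument with S and R^op exchanged shows that F → Hom_S(C,
C ⊗_R F) is bijective (`bijective_coevMap`).

Membership in either class thus becomes intrinsic (`wic_iff`, `wfc_iff`): the adjoint functor lands
in the weak class and the unit or counit is bijective. This settles summands and direct limits,
where maps between members must be transported. For products and direct sums one combines chosen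
weak flat or weak injective modules, since both functors commute with these operations, by finite
presentation of C where needed. -/

namespace CWeak

noncomputable section

/-! ### Resolutions by finitely generated free modules -/

section SuperFinitelyPresented

variable {A : Type u} [Ring A]

/-- A class of modules such that each member is covered by a finitely generated free module with
kernel in the class. -/
def FreeResolving (P : ModuleCat.{u} A → Prop) : Prop :=
  ∀ X, P X → ∃ (Q : ModuleCat.{u} A) (f : Q →ₗ[A] X), Module.Free A Q ∧ Module.Finite A Q ∧
    Function.Surjective f ∧ P (ModuleCat.of A (LinearMap.ker f))

/-- Iterating the choice of a cover gives the syzygies `Z n`; splicing each cover with the inclusion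
of the kernel before it gives the differentials. -/
theorem FreeResolving.exists_exact_sequence {P : ModuleCat.{u} A → Prop} (h : FreeResolving P)
    {N : ModuleCat.{u} A} (hN : P N) :
    ∃ (X : ℕ → ModuleCat.{u} A) (d : ∀ n, X (n + 1) →ₗ[A] X n) (p : X 0 →ₗ[A] N),
      (∀ n, Module.Free A (X n) ∧ Module.Finite A (X n)) ∧ Function.Surjective p ∧
      Function.Exact (d 0) p ∧ ∀ n, Function.Exact (d (n + 1)) (d n) := by
  choose Q f hfree hfin hsurj hker using h
  let Z : ℕ → {X // P X} := fun n => Nat.rec ⟨N, hN⟩ (fun _ X => ⟨_, hker X.1 X.2⟩) n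
  let g (n : ℕ) : Q (Z (n + 1)).1 (Z (n + 1)).2 →ₗ[A] LinearMap.ker (f (Z n).1 (Z n).2) :=
    f (Z (n + 1)).1 (Z (n + 1)).2
  have hg (n : ℕ) : Function.Surjective (g n) := hsurj (Z (n + 1)).1 (Z (n + 1)).2
  have hex (n : ℕ) : Function.Exact ((LinearMap.ker (f (Z n).1 (Z n).2)).subtype ∘ₗ g n)
      (f (Z n).1 (Z n).2) := by
    rw [LinearMap.exact_iff, LinearMap.range_comp, LinearMap.range_eq_top.2 (hg n)]
    simp
  refine ⟨fun n => Q (Z n).1 (Z n).2, fun n => (LinearMap.ker (f (Z n).1 (Z n).2)).subtype ∘ₗ g n,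
    f N hN, fun n => ⟨hfree _ _, hfin _ _⟩, hsurj _ _, hex 0, fun n x => ?_⟩
  rw [← hex (n + 1) x]
  exact Submodule.coe_eq_zero

theorem exists_projectiveResolution_of_exact {N : ModuleCat.{u} A} (X : ℕ → ModuleCat.{u} A)
    (d : ∀ n, X (n + 1) →ₗ[A] X n) (p : X 0 →ₗ[A] N) (hX : ∀ n, Module.Projective A (X n))
    (hp : Function.Surjective p) (h0 : Function.Exact (d 0) p)
    (hd : ∀ n, Function.Exact (d (n + 1)) (d n)) :
    ∃ Q : ProjectiveResolution N, Q.complex.X = X := by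
  have sq (n : ℕ) : ModuleCat.ofHom (d (n + 1)) ≫ ModuleCat.ofHom (d n) = 0 :=
    ModuleCat.hom_ext (LinearMap.ext (hd n).apply_apply_eq_zero)
  let K : ChainComplex (ModuleCat.{u} A) ℕ := ChainComplex.of X (fun n => ModuleCat.ofHom (d n)) sq
  have hK (n : ℕ) : K.d (n + 1) n = ModuleCat.ofHom (d n) := ChainComplex.of_d X (fun n => ModuleCat.ofHom (d n)) n
  have w : K.d 1 0 ≫ ModuleCat.ofHom p = 0 := by
    rw [hK 0]
    exact ModuleCat.hom_ext (LinearMap.ext h0.apply_apply_eq_zero)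
  have hproj (n : ℕ) : Projective (K.X n) :=
    (IsProjective.iff_projective (X n)).1 (hX n)
  have hexact (n : ℕ) : K.ExactAt (n + 1) := by
    rw [HomologicalComplex.exactAt_iff' _ (n + 1 + 1) (n + 1) n (by simp) (by simp),
      ShortComplex.ShortExact.moduleCat_exact_iff_function_exact]
    change Function.Exact (K.d (n + 1 + 1) (n + 1)) (K.d (n + 1) n)
    rw [hK, hK]
    exact hd n
  refine ⟨{ complex := K
            projective := hproj
            π := (ChainComplex.toSingle₀Equiv _ _).symm ⟨ModuleCat.ofHom p, w⟩
            quasiIso := ⟨fun n => ?_⟩ }, rfl⟩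
  cases n with
  | zero =>
    rw [ChainComplex.quasiIsoAt₀_iff, ShortComplex.quasiIso_iff_of_zeros']
    · refine (ShortComplex.exact_and_epi_g_iff_of_iso
        (S₂ := ShortComplex.mk (K.d 1 0) (ModuleCat.ofHom p) w) ?_).2 ⟨?_, ?_⟩
      · exact ShortComplex.isoMk (Iso.refl _) (Iso.refl _) (Iso.refl _)
          ((Category.id_comp _).trans (Category.comp_id _).symm)
          ((Category.id_comp _).trans (Category.comp_id _).symm)
      · rw [ShortComplex.ShortExact.moduleCat_exact_iff_function_exact]
        change Function.Exact (K.d 1 0) p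
        rw [hK 0]
        exact h0
      · exact (ModuleCat.epi_iff_surjective _).2 hp
    all_goals rfl
  | succ n =>
    rw [quasiIsoAt_iff_exactAt']
    · exact hexact n
    · apply ChainComplex.exactAt_succ_single_obj

theorem FreeResolving.exists_resolution {P : ModuleCat.{u} A → Prop} (h : FreeResolving P)
    {N : ModuleCat.{u} A} (hN : P N) :
    ∃ Q : ProjectiveResolution N, ∀ n,
      Module.Free A (Q.complex.X n) ∧ Module.Finite A (Q.complex.X n) := by
  obtain ⟨X, d, p, hX, hp, h0, hd⟩ := h.exists_exact_sequence hN
  obtain ⟨Q, hQ⟩ := exists_projectiveResolution_of_exact X d p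
    (fun n => have := (hX n).1; Module.Projective.of_free) hp h0 hd
  exact ⟨Q, hQ ▸ hX⟩

theorem FreeResolving.superFinitelyPresented {P : ModuleCat.{u} A → Prop} (h : FreeResolving P)
    {N : ModuleCat.{u} A} (hN : P N) : SuperFinitelyPresented A N :=
  (h.exists_resolution hN).imp fun _ hQ n => (hQ n).2

/-- The augmentation of a projective resolution, as a linear map. -/
def augmentation {N : ModuleCat.{u} A} (Q : ProjectiveResolution N) : Q.complex.X 0 →ₗ[A] N :=
  (Q.π.f 0).hom

theorem surjective_augmentation {N : ModuleCat.{u} A} (Q : ProjectiveResolution N) :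
    Function.Surjective (augmentation Q) :=
  (ModuleCat.epi_iff_surjective (Q.π.f 0)).1 inferInstance

theorem exact_augmentation {N : ModuleCat.{u} A} (Q : ProjectiveResolution N) :
    Function.Exact (Q.complex.d 1 0).hom (augmentation Q) :=
  (ShortComplex.ShortExact.moduleCat_exact_iff_function_exact _).1 Q.exact₀

theorem exact_resolution_d {N : ModuleCat.{u} A}
    (Q : ProjectiveResolution N) (n : ℕ) :
    Function.Exact (Q.complex.d (n + 2) (n + 1)).hom (Q.complex.d (n + 1) n).hom :=
  (ShortComplex.ShortExact.moduleCat_exact_iff_function_exact _).1 (Q.exact_succ n)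

/-- A surjection from a free module of finite rank onto P splits, and its kernel is the complement.
-/
theorem exists_projective_complement (P : Type u) [AddCommGroup P] [Module A P]
    [Module.Projective A P] [Module.Finite A P] :
    ∃ E : ModuleCat.{u} A, Module.Projective A E ∧ Module.Finite A E ∧
      Module.Free A (P × E) := by
  obtain ⟨n, f, hf⟩ := Module.Finite.exists_fin' A P
  obtain ⟨s, hs⟩ := Module.projective_lifting_property f LinearMap.id hf
  have hs' (p : P) : f (s p) = p := LinearMap.congr_fun hs p
  let r : (Fin n → A) →ₗ[A] LinearMap.ker f :=
    (LinearMap.id - s ∘ₗ f).codRestrict _ fun x => by simp [hs']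
  have hr (x : LinearMap.ker f) : r x = x := by
    apply Subtype.ext
    simp [r]
  let e : (Fin n → A) ≃ₗ[A] P × LinearMap.ker f :=
    LinearEquiv.ofLinearMap (f.prod r) (s.coprod (LinearMap.ker f).subtype)
      (by
        refine LinearMap.ext fun x => Prod.ext ?_ (Subtype.ext ?_)
        · simp [hs']
        · simp [r, hs'])
      (LinearMap.ext fun x => by simp [r])
  exact ⟨ModuleCat.of A (LinearMap.ker f),
    Module.Projective.of_split (LinearMap.ker f).subtype r (LinearMap.ext hr),
    Module.Finite.of_surjective r fun x => ⟨x, hr x⟩, Module.Free.of_equiv e⟩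

/-- Projective covers are made free by carrying a projective error term along. If T covers K and E
complements Q × T to a free module, then (Q × T) × E covers K × Q with kernel ker f × E, which is
again of the required shape. -/
theorem freeResolving_of_projective {P : ModuleCat.{u} A → Prop}
    (h : ∀ X, P X → ∃ (Q : ModuleCat.{u} A) (f : Q →ₗ[A] X), Module.Projective A Q ∧
      Module.Finite A Q ∧ Function.Surjective f ∧ P (ModuleCat.of A (LinearMap.ker f))) :
    FreeResolving fun X : ModuleCat.{u} A => ∃ K Q : ModuleCat.{u} A, P K ∧ Module.Projective A Q ∧
      Module.Finite A Q ∧ Nonempty (X ≃ₗ[A] K × Q) := by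
  rintro X ⟨K, Q, hK, _, _, ⟨e⟩⟩
  obtain ⟨T, f, _, _, hf, hker⟩ := h K hK
  obtain ⟨E, _, _, _⟩ := exists_projective_complement (Q × T) (A := A)
  let g : (Q × T) × E →ₗ[A] K × Q :=
    ((f ∘ₗ LinearMap.snd A Q T).prod (LinearMap.fst A Q T)) ∘ₗ LinearMap.fst A (Q × T) E
  refine ⟨ModuleCat.of A ((Q × T) × E), e.symm.toLinearMap ∘ₗ g, ‹_›, inferInstance, ?_,
    ModuleCat.of A (LinearMap.ker f), E, hker, ‹_›, ‹_›, ⟨?_⟩⟩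
  · refine e.symm.surjective.comp fun y => ?_
    obtain ⟨t, ht⟩ := hf y.1
    exact ⟨((y.2, t), 0), Prod.ext ht rfl⟩
  · have hg (x : (Q × T) × E) : (e.symm.toLinearMap ∘ₗ g) x = 0 ↔ f x.1.2 = 0 ∧ x.1.1 = 0 := by
      simp [g, Prod.ext_iff]
    refine LinearEquiv.ofLinearMap
      ((((LinearMap.snd A Q T ∘ₗ LinearMap.fst A (Q × T) E) ∘ₗ Submodule.subtype _).codRestrict
        (LinearMap.ker f) fun x => ((hg _).1 x.2).1).prod
          (LinearMap.snd A (Q × T) E ∘ₗ Submodule.subtype _))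
      (((((0 : _ →ₗ[A] Q).prod (LinearMap.ker f).subtype) ∘ₗ LinearMap.fst A _ E).prod
        (LinearMap.snd A _ E)).codRestrict _ fun x => ?_) ?_ ?_
    · exact (hg _).2 ⟨x.1.2, rfl⟩
    · exact LinearMap.ext fun x => rfl
    · refine LinearMap.ext fun x => Subtype.ext (Prod.ext (Prod.ext ?_ rfl) rfl)
      exact ((hg _).1 x.2).2.symm

variable (A) in
/-- Super finitely presented modules have resolutions by finitely generated free modules. -/
theorem freeResolving_superFinitelyPresented : FreeResolving (SuperFinitelyPresented A) := by
  have key (N : ModuleCat.{u} A) (hN : SuperFinitelyPresented A N) :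
      ∃ P : ModuleCat.{u} A → Prop, FreeResolving P ∧ P N := by
    obtain ⟨Q, hQ⟩ := hN
    have hproj (n : ℕ) : Module.Projective A (Q.complex.X n) :=
      (IsProjective.iff_projective _).2 (Q.projective n)
    -- The class consists of the syzygies of the given projective resolution: N itself and the
    -- images of the differentials.
    refine ⟨_, freeResolving_of_projective (P := fun X => Nonempty (X ≃ₗ[A] N) ∨
      ∃ n, Nonempty (X ≃ₗ[A] LinearMap.range (Q.complex.d (n + 1) n).hom)) ?_,
      N, ModuleCat.of A PUnit, Or.inl ⟨LinearEquiv.refl A N⟩, ?_, ?_,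
      ⟨(LinearEquiv.prodUnique (R := A) (M := N) (M₂ := PUnit.{u + 1})).symm⟩⟩
    · rintro X (⟨⟨e⟩⟩ | ⟨n, ⟨e⟩⟩)
      · refine ⟨Q.complex.X 0, e.symm.toLinearMap ∘ₗ augmentation Q, hproj 0, hQ 0,
          e.symm.surjective.comp (surjective_augmentation Q), Or.inr ⟨0, ⟨LinearEquiv.ofEq _ _ ?_⟩⟩⟩
        rw [LinearEquiv.ker_comp]
        exact LinearMap.exact_iff.1 (exact_augmentation Q)
      · refine ⟨Q.complex.X (n + 1), e.symm.toLinearMap ∘ₗ (Q.complex.d (n + 1) n).hom.rangeRestrict,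
          hproj _, hQ _, e.symm.surjective.comp (LinearMap.surjective_rangeRestrict _),
          Or.inr ⟨n + 1, ⟨LinearEquiv.ofEq _ _ ?_⟩⟩⟩
        rw [LinearEquiv.ker_comp, LinearMap.ker_rangeRestrict]
        exact LinearMap.exact_iff.1 (exact_resolution_d Q n)
    · dsimp; infer_instance
    · dsimp; infer_instance
  intro N hN
  obtain ⟨P, hP, hPN⟩ := key N hN
  obtain ⟨Q, f, h1, h2, h3, h4⟩ := hP N hPN
  exact ⟨Q, f, h1, h2, h3, hP.superFinitelyPresented h4⟩

theorem SuperFinitelyPresented.exists_free_resolution {N : ModuleCat.{u} A}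
    (hN : SuperFinitelyPresented A N) : ∃ Q : ProjectiveResolution N, ∀ n,
      Module.Free A (Q.complex.X n) ∧ Module.Finite A (Q.complex.X n) :=
  (freeResolving_superFinitelyPresented A).exists_resolution hN

theorem SuperFinitelyPresented.finite {N : ModuleCat.{u} A}
    (hN : SuperFinitelyPresented A N) : Module.Finite A N :=
  have ⟨_, f, _, _, hf, _⟩ := freeResolving_superFinitelyPresented A N hN
  Module.Finite.of_surjective f hf

/-- A module covered by a finitely generated free module with super finitely presented kernel is
super finitely presented. -/
theorem SuperFinitelyPresented.of_cover {Q N : Type u} [AddCommGroup Q] [Module A Q]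
    [AddCommGroup N] [Module A N] [Module.Free A Q] [Module.Finite A Q] (f : Q →ₗ[A] N)
    (hf : Function.Surjective f)
    (h : SuperFinitelyPresented A (ModuleCat.of A (LinearMap.ker f))) :
    SuperFinitelyPresented A (ModuleCat.of A N) := by
  refine FreeResolving.superFinitelyPresented
    (P := fun N => ∃ (Q : ModuleCat.{u} A) (f : Q →ₗ[A] N), Module.Free A Q ∧ Module.Finite A Q ∧
      Function.Surjective f ∧ SuperFinitelyPresented A (ModuleCat.of A (LinearMap.ker f)))
    ?_ ⟨ModuleCat.of A Q, f, ‹_›, ‹_›, hf, h⟩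
  rintro X ⟨Q, f, h1, h2, h3, h4⟩
  exact ⟨Q, f, h1, h2, h3, freeResolving_superFinitelyPresented A _ h4⟩

theorem SuperFinitelyPresented.of_equiv {M N : Type u} [AddCommGroup M] [Module A M]
    [AddCommGroup N] [Module A N] (e : M ≃ₗ[A] N)
    (h : SuperFinitelyPresented A (ModuleCat.of A M)) :
    SuperFinitelyPresented A (ModuleCat.of A N) := by
  obtain ⟨Q, f, _, _, hf, hker⟩ := freeResolving_superFinitelyPresented A _ h
  refine .of_cover (e.toLinearMap ∘ₗ f) (e.surjective.comp hf) ?_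
  rwa [LinearEquiv.ker_comp]

theorem SuperFinitelyPresented.of_subsingleton (N : Type u) [AddCommGroup N] [Module A N]
    [Subsingleton N] : SuperFinitelyPresented A (ModuleCat.of A N) :=
  FreeResolving.superFinitelyPresented (P := fun X => Subsingleton X)
    (fun X _ => ⟨ModuleCat.of A PUnit, 0, by dsimp; infer_instance, by dsimp; infer_instance,
      fun x => ⟨0, Subsingleton.elim _ _⟩, by dsimp; infer_instance⟩) ‹_›

theorem SuperFinitelyPresented.of_free (N : Type u) [AddCommGroup N] [Module A N]
    [Module.Free A N] [Module.Finite A N] : SuperFinitelyPresented A (ModuleCat.of A N) :=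
  .of_cover LinearMap.id Function.surjective_id <| by
    rw [LinearMap.ker_id]
    exact .of_subsingleton _

/-- The class of super finitely presented modules is closed under extensions. -/
theorem SuperFinitelyPresented.of_extension {X Y Z : Type u} [AddCommGroup X] [Module A X]
    [AddCommGroup Y] [Module A Y] [AddCommGroup Z] [Module A Z] (f : X →ₗ[A] Y) (g : Y →ₗ[A] Z)
    (hf : Function.Injective f) (hg : Function.Surjective g) (hfg : Function.Exact f g)
    (hX : SuperFinitelyPresented A (ModuleCat.of A X))
    (hZ : SuperFinitelyPresented A (ModuleCat.of A Z)) :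
    SuperFinitelyPresented A (ModuleCat.of A Y) := by
  refine FreeResolving.superFinitelyPresented
    (P := fun Y => ∃ (X Z : ModuleCat.{u} A) (f : X →ₗ[A] Y) (g : Y →ₗ[A] Z),
      Function.Injective f ∧ Function.Surjective g ∧ Function.Exact f g ∧
      SuperFinitelyPresented A X ∧ SuperFinitelyPresented A Z)
    ?_ ⟨ModuleCat.of A X, ModuleCat.of A Z, f, g, hf, hg, hfg, hX, hZ⟩
  rintro Y ⟨X, Z, f, g, hf, hg, hfg, hX, hZ⟩
  obtain ⟨P, p, _, _, hp, hkerp⟩ := freeResolving_superFinitelyPresented A _ hX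
  obtain ⟨Q, q, _, _, hq, hkerq⟩ := freeResolving_superFinitelyPresented A _ hZ
  have : Module.Projective A Q := .of_free
  obtain ⟨s, hs⟩ := Module.projective_lifting_property g q hg
  have hs' (y : Q) : g (s y) = q y := LinearMap.congr_fun hs y
  -- Horseshoe construction: the kernel of `h` is an extension of ker q by ker p, so the class of
  -- extensions is stable under syzygies.
  let h : P × Q →ₗ[A] Y := (f ∘ₗ p).coprod s
  have hgh (x : P × Q) : g (h x) = q x.2 := by
    simp [h, hs', hfg.apply_apply_eq_zero]
  have hfst (x : P) : h (x, 0) = f (p x) := by simp [h]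
  refine ⟨ModuleCat.of A (P × Q), h, by dsimp; infer_instance, by dsimp; infer_instance, ?_,
    ModuleCat.of A (LinearMap.ker p), ModuleCat.of A (LinearMap.ker q),
    (LinearMap.inl A P Q ∘ₗ (LinearMap.ker p).subtype).codRestrict _ ?_,
    (LinearMap.snd A P Q ∘ₗ (LinearMap.ker h).subtype).codRestrict _ ?_, ?_, ?_, ?_, hkerp, hkerq⟩
  · intro y
    obtain ⟨b, hb⟩ := hq (g y)
    obtain ⟨x, hx⟩ := (hfg (y - s b)).1 (by rw [map_sub, hs', hb, sub_self])
    obtain ⟨a, rfl⟩ := hp x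
    exact ⟨(a, b), by simp [h, hx]⟩
  · intro x
    simp [h]
  · intro x
    exact (hgh x.1).symm.trans (by rw [LinearMap.mem_ker.1 x.2, map_zero])
  · intro x y hxy
    exact Subtype.ext (congrArg (fun z => z.1.1) hxy)
  · rintro ⟨b, hb⟩
    obtain ⟨x, hx⟩ := (hfg (s b)).1 (by rw [hs']; exact hb)
    obtain ⟨a, rfl⟩ := hp x
    exact ⟨⟨(-a, b), by simp [h, hx]⟩, rfl⟩
  · rintro ⟨⟨a, b⟩, hab⟩
    constructor
    · intro hb
      obtain rfl : b = 0 := congrArg Subtype.val hb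
      refine ⟨⟨a, hf ?_⟩, rfl⟩
      rw [← hfst, map_zero]
      exact hab
    · rintro ⟨x, hx⟩
      exact Subtype.ext (congrArg (fun z => z.1.2) hx).symm

/-- The cokernel of an injective map of super finitely presented modules is super finitely
presented. -/
theorem SuperFinitelyPresented.of_coker {X Y Z : Type u} [AddCommGroup X] [Module A X]
    [AddCommGroup Y] [Module A Y] [AddCommGroup Z] [Module A Z] (f : X →ₗ[A] Y) (g : Y →ₗ[A] Z)
    (hf : Function.Injective f) (hg : Function.Surjective g) (hfg : Function.Exact f g)
    (hX : SuperFinitelyPresented A (ModuleCat.of A X))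
    (hY : SuperFinitelyPresented A (ModuleCat.of A Y)) :
    SuperFinitelyPresented A (ModuleCat.of A Z) := by
  obtain ⟨P, p, _, _, hp, hkerp⟩ := freeResolving_superFinitelyPresented A _ hY
  refine .of_cover (g ∘ₗ p) (hg.comp hp) ?_
  have hrange : LinearMap.range f = LinearMap.ker g := (LinearMap.exact_iff.1 hfg).symm
  -- The kernel of g ∘ p is the preimage under p of the image of f, hence an extension of that image
  -- by ker p.
  let k : LinearMap.ker (g ∘ₗ p) →ₗ[A] LinearMap.range f :=
    (p ∘ₗ Submodule.subtype _).codRestrict _ fun x => hrange ▸ x.2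
  refine .of_extension (X := LinearMap.ker p) (Z := LinearMap.range f)
    (Submodule.inclusion fun x hx => by simp_all) k (Submodule.inclusion_injective _) ?_ ?_ hkerp
    (hX.of_equiv (LinearEquiv.ofInjective f hf))
  · rintro ⟨y, hy⟩
    obtain ⟨x, rfl⟩ := hp y
    exact ⟨⟨x, by rw [hrange] at hy; exact hy⟩, rfl⟩
  · rintro ⟨x, hx⟩
    constructor
    · intro h
      exact ⟨⟨x, congrArg Subtype.val h⟩, rfl⟩
    · rintro ⟨z, hz⟩
      exact Subtype.ext (by rw [← hz]; exact z.2)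

theorem SuperFinitelyPresented.pi {M : Type u} [AddCommGroup M] [Module A M]
    (h : SuperFinitelyPresented A (ModuleCat.of A M)) (n : ℕ) :
    SuperFinitelyPresented A (ModuleCat.of A (Fin n → M)) := by
  induction n with
  | zero => exact .of_subsingleton _
  | succ n ih =>
    have h2 : SuperFinitelyPresented A (ModuleCat.of A (M × (Fin n → M))) :=
      .of_extension (LinearMap.inl A _ _) (LinearMap.snd A _ _) LinearMap.inl_injective
        LinearMap.snd_surjective .inl_snd h ih
    exact h2.of_equiv (Fin.consLinearEquiv A fun _ => M)

end SuperFinitelyPresented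

/-! ### Finite families of elements in direct limits -/

section DirectLimit

variable {A : Type*} [Ring A] {ι : Type*} [Preorder ι] [DecidableEq ι] [IsDirectedOrder ι]
  {M : ι → Type*} [∀ i, AddCommGroup (M i)] [∀ i, Module A (M i)]
  {f : ∀ i j, i ≤ j → M i →ₗ[A] M j}

theorem directLimit_exists_lift [Nonempty ι] {κ : Type*} [Finite κ]
    (y : κ → Module.DirectLimit M f) :
    ∃ (i : ι) (x : κ → M i), ∀ k, Module.DirectLimit.of A ι M f i (x k) = y k := by
  choose i x hx using fun k => Module.DirectLimit.exists_of (y k)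
  obtain ⟨j, hj⟩ := Finite.exists_le i
  exact ⟨j, fun k => f _ _ (hj k) (x k), fun k => by rw [Module.DirectLimit.of_f, hx]⟩

theorem directLimit_exists_map_eq_zero [DirectedSystem M fun i j h => f i j h] {κ : Type*}
    [Finite κ] {i : ι} (x : κ → M i) (hx : ∀ k, Module.DirectLimit.of A ι M f i (x k) = 0) :
    ∃ (j : ι) (h : i ≤ j), ∀ k, f i j h (x k) = 0 := by
  have : Nonempty ι := ⟨i⟩
  choose j hij hj using fun k => Module.DirectLimit.of.zero_exact (hx k)
  obtain ⟨l, hl⟩ := Finite.exists_le (Option.elim · i j)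
  have hil : i ≤ l := hl none
  have hjl (k : κ) : j k ≤ l := hl (some k)
  refine ⟨l, hil, fun k => ?_⟩
  have : f (j k) l (hjl k) (f i (j k) (hij k) (x k)) = f i l hil (x k) :=
    DirectedSystem.map_map (f := fun i j h => f i j h) (hij k) (hjl k) (x k)
  rw [← this, hj, map_zero]

end DirectLimit

/-! ### Classes of modules defined by exactness of pairs of matrices -/

section Matrix

variable {A : Type u} [Ring A]

/-- The action of a matrix with entries in `A` on column vectors with entries in an `A`-module. -/
def matrixAct {m n : Type*} [Fintype n] (D : m → n → A) {M : Type*} [AddCommGroup M] [Module A M]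
    (x : n → M) : m → M :=
  fun i => ∑ j, D i j • x j

theorem map_matrixAct {m n : Type*} [Fintype n] (D : m → n → A) {M N : Type*} [AddCommGroup M]
    [Module A M] [AddCommGroup N] [Module A N] (f : M →ₗ[A] N) (x : n → M) (i : m) :
    f (matrixAct D x i) = matrixAct D (fun j => f (x j)) i := by
  simp [matrixAct]

variable (A) in
/-- A pair of composable matrices. -/
structure MatrixPair where
  (a b c : Type u)
  [fintype_a : Fintype a]
  [fintype_b : Fintype b]
  [fintype_c : Fintype c]
  /-- the first matrix -/
  fst : b → a → A
  /-- the second matrix -/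
  snd : c → b → A

attribute [instance] MatrixPair.fintype_a MatrixPair.fintype_b MatrixPair.fintype_c

/-- The kernel of the action of the second matrix is contained in the range of that of the first. -/
def MatrixPair.Exact (p : MatrixPair A) (M : Type*) [AddCommGroup M] [Module A M] : Prop :=
  ∀ y : p.b → M, matrixAct p.snd y = 0 → ∃ x : p.a → M, matrixAct p.fst x = y

/-- A class of modules given by the exactness of a family of pairs of matrices. -/
def MatrixDefinable (P : ModuleCat.{u} A → Prop) : Prop :=
  ∃ D : Set (MatrixPair A), ∀ M : ModuleCat.{u} A, P M ↔ ∀ p ∈ D, p.Exact M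

namespace MatrixDefinable

variable {P : ModuleCat.{u} A → Prop} (hP : MatrixDefinable P)

include hP

theorem of_retract {X M : Type u} [AddCommGroup X] [Module A X] [AddCommGroup M] [Module A M]
    (i : X →ₗ[A] M) (r : M →ₗ[A] X) (hr : ∀ x, r (i x) = x) (hM : P (ModuleCat.of A M)) :
    P (ModuleCat.of A X) := by
  obtain ⟨D, hD⟩ := hP
  rw [hD] at hM ⊢
  intro p hp y hy
  obtain ⟨x, hx⟩ := hM p hp (fun j => i (y j)) (by
    ext j
    rw [← map_matrixAct, hy]
    simp)
  refine ⟨fun j => r (x j), ?_⟩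
  ext j
  rw [← map_matrixAct, hx, hr]

theorem of_equiv {X M : Type u} [AddCommGroup X] [Module A X] [AddCommGroup M] [Module A M]
    (e : M ≃ₗ[A] X) (hM : P (ModuleCat.of A M)) : P (ModuleCat.of A X) :=
  hP.of_retract e.symm.toLinearMap e.toLinearMap e.apply_symm_apply hM

theorem closedUnderProducts : ClosedUnderProducts P := by
  intro ι M hM
  obtain ⟨D, hD⟩ := hP
  simp only [hD] at hM ⊢
  intro p hp y hy
  choose x hx using fun i => hM i p hp (fun j => y j i) (by
    ext j
    exact (map_matrixAct p.snd (LinearMap.proj i : (∀ i, M i) →ₗ[A] M i) y j).symm.trans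
      (congrFun (congrFun hy j) i))
  refine ⟨fun j i => x i j, ?_⟩
  refine funext fun j => funext fun i => ?_
  exact (map_matrixAct p.fst (LinearMap.proj i : (∀ i, M i) →ₗ[A] M i) _ j).trans
      (congrFun (hx i) j)

theorem closedUnderDirectSums : ClosedUnderDirectSums P := by
  classical
  intro ι M hM
  obtain ⟨D, hD⟩ := hP
  simp only [hD] at hM ⊢
  intro p hp (y : p.b → ⨁ i, M i) hy
  choose x hx using fun i => hM i p hp (fun j => y j i) (by
    ext j
    exact (map_matrixAct p.snd (DirectSum.component A ι (fun i => M i) i) y j).symm.trans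
      (congrArg (fun z : ⨁ i, M i => z i) (congrFun hy j)))
  -- The componentwise solutions need not have finite support; they are cut off to the union of the
  -- finitely many supports of the entries of `y`.
  let s : Finset ι := Finset.univ.biUnion fun j => DFinsupp.support (β := fun i => M i) (y j)
  let z (j : p.a) : ⨁ i, M i := DirectSum.mk (fun i => M i) s fun i => x i j
  refine ⟨z, ?_⟩
  ext j i
  refine (map_matrixAct p.fst (DirectSum.component A ι (fun i => M i) i) z j).trans ?_
  by_cases hi : i ∈ s
  · refine Eq.trans ?_ (congrFun (hx i) j)
    congr 1
    ext k
    exact DirectSum.mk_apply_of_mem (β := fun i => M i) (f := fun i : (s : Set ι) => x i k) hi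
  · have hz : (fun k => DirectSum.component A ι (fun i => M i) i (z k)) = 0 := by
      ext k
      exact DirectSum.mk_apply_of_notMem (β := fun i => M i) (f := fun i : (s : Set ι) => x i k) hi
    rw [hz]
    have : y j i = 0 := by
      by_contra h
      exact hi (Finset.mem_biUnion.2 ⟨j, Finset.mem_univ _, DFinsupp.mem_support_iff.2 h⟩)
    rw [this]
    simp [matrixAct]

theorem closedUnderDirectLimits : ClosedUnderDirectLimits P := by
  classical
  intro ι _ _ _ M f _ hM
  obtain ⟨D, hD⟩ := hP
  simp only [hD] at hM ⊢
  intro p hp y hy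
  -- Both the column and the equations it satisfies are finite in number, so they already hold at
  -- some stage, where the system can be solved.
  obtain ⟨i, y, hy'⟩ := directLimit_exists_lift y
  obtain rfl : _ = _ := funext hy'
  obtain ⟨j, hij, hj⟩ := directLimit_exists_map_eq_zero (f := f) (matrixAct p.snd y) fun k =>
    (map_matrixAct _ _ _ _).trans (congrFun hy k)
  obtain ⟨x, hx⟩ := hM j p hp (fun k => f i j hij (y k)) (by
    ext k
    rw [← map_matrixAct, hj]
    rfl)
  refine ⟨fun k => Module.DirectLimit.of A ι (fun i => M i) f j (x k), ?_⟩
  ext k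
  refine (map_matrixAct _ _ _ _).symm.trans ?_
  rw [hx, Module.DirectLimit.of_f]

end MatrixDefinable

end Matrix

/-! ### Vanishing of Ext¹ and extension of maps -/

section WeakInjective

variable {A : Type u} [Ring A]

theorem WeakInjective.exists_extension {I : Type u} [AddCommGroup I] [Module A I]
    (hI : WeakInjective A (ModuleCat.of A I)) {X Y Z : Type u} [AddCommGroup X] [Module A X]
    [AddCommGroup Y] [Module A Y] [AddCommGroup Z] [Module A Z] (f : X →ₗ[A] Y) (g : Y →ₗ[A] Z)
    (hf : Function.Injective f) (hg : Function.Surjective g) (hfg : Function.Exact f g)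
    (hZ : SuperFinitelyPresented A (ModuleCat.of A Z)) (φ : X →ₗ[A] I) :
    ∃ ψ : Y →ₗ[A] I, ψ ∘ₗ f = φ := by
  have hS := ModuleCat.shortComplex_shortExact
    (ModuleCat.shortComplexOfCompEqZero f g hfg.linearMap_comp_eq_zero) hfg hf hg
  have := hI _ hZ
  obtain ⟨x, hx⟩ := Abelian.Ext.contravariant_sequence_exact₁ hS _
    (Abelian.Ext.mk₀ (ModuleCat.ofHom φ)) (add_zero 1) (Subsingleton.elim _ _)
  obtain ⟨ψ, rfl⟩ := (Abelian.Ext.mk₀_bijective _ _).2 x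
  rw [Abelian.Ext.mk₀_comp_mk₀] at hx
  exact ⟨ψ.hom, congrArg ModuleCat.Hom.hom ((Abelian.Ext.mk₀_bijective _ _).1 hx)⟩

/-- As Q is projective, every class in Ext¹(N, I) comes from a map ker g → I by the connecting map,
and such a class is zero once the map extends to Q. -/
theorem subsingleton_ext_one_of_exists_extension {I N Q : ModuleCat.{u} A} [Module.Projective A Q]
    (g : Q →ₗ[A] N) (hg : Function.Surjective g)
    (h : ∀ φ : LinearMap.ker g →ₗ[A] I, ∃ ψ : Q →ₗ[A] I, ψ ∘ₗ (LinearMap.ker g).subtype = φ) :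
    Subsingleton (Abelian.Ext.{u} N I 1) := by
  have hS := ModuleCat.shortComplex_shortExact
    (ModuleCat.shortComplexOfCompEqZero (LinearMap.ker g).subtype g
      (LinearMap.comp_ker_subtype g)) (LinearMap.exact_subtype_ker_map g)
      (Submodule.injective_subtype _) hg
  have hQ : Projective (ModuleCat.of A Q) := (IsProjective.iff_projective Q).1 ‹_›
  refine subsingleton_of_forall_eq 0 fun x => ?_
  obtain ⟨y, rfl⟩ := Abelian.Ext.contravariant_sequence_exact₃ hS _ x
    (Abelian.Ext.eq_zero_of_projective _) (add_zero 1)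
  obtain ⟨φ, rfl⟩ := (Abelian.Ext.mk₀_bijective _ _).2 y
  obtain ⟨ψ, hψ⟩ := h φ.hom
  have : φ = ModuleCat.ofHom (LinearMap.ker g).subtype ≫ ModuleCat.ofHom ψ :=
    ModuleCat.hom_ext hψ.symm
  rw [this, ← Abelian.Ext.mk₀_comp_mk₀]
  exact hS.extClass_comp_assoc _

end WeakInjective

/-! ### Elements and maps of the tensor product over a noncommutative ring -/

section BalTensor

variable {S R : Type*} [Ring S] [Ring R]
variable {C : Type*} [AddCommGroup C] [Module S C] [Module Rᵐᵒᵖ C]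
variable {F : Type*} [AddCommGroup F] [Module R F]

variable (S R) in
/-- The element `c ⊗ x` of `C ⊗_R F`. -/
def balMk (c : C) (x : F) : BalTensor S R C F :=
  (balancedRel S R C F).mkQ (c ⊗ₜ[ℤ] x)

theorem balMk_add_left (c c' : C) (x : F) :
    balMk S R (c + c') x = balMk S R c x + balMk S R c' x := by
  simp only [balMk, TensorProduct.add_tmul, map_add]

theorem balMk_add_right (c : C) (x x' : F) :
    balMk S R c (x + x') = balMk S R c x + balMk S R c x' := by
  simp only [balMk, TensorProduct.tmul_add, map_add]

theorem smul_balMk (s : S) (c : C) (x : F) : s • balMk S R c x = balMk S R (s • c) x := rfl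

theorem balMk_op_smul (r : R) (c : C) (x : F) :
    balMk S R (op r • c) x = balMk S R c (r • x) := by
  rw [← sub_eq_zero]
  simp only [balMk]
  rw [← map_sub]
  exact (Submodule.Quotient.mk_eq_zero _).2 (Submodule.subset_span ⟨c, r, x, rfl⟩)

variable (S R F) in
/-- The map `x ↦ c ⊗ x`, as an additive map in `c` and `x`. -/
def balMkHom : C →+ F →+ BalTensor S R C F :=
  AddMonoidHom.mk' (fun c => AddMonoidHom.mk' (balMk S R c) (balMk_add_right c))
    fun c c' => AddMonoidHom.ext (balMk_add_left c c')

theorem balMk_sum_left {κ : Type*} (s : Finset κ) (c : κ → C) (x : F) :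
    balMk S R (∑ k ∈ s, c k) x = ∑ k ∈ s, balMk S R (c k) x :=
  map_sum ((balMkHom S R F).flip x) c s

theorem balMk_sum_right {κ : Type*} (s : Finset κ) (c : C) (x : κ → F) :
    balMk S R c (∑ k ∈ s, x k) = ∑ k ∈ s, balMk S R c (x k) :=
  map_sum (balMkHom S R F c) x s

theorem balMk_zero_left (x : F) : balMk S R (0 : C) x = 0 :=
  map_zero ((balMkHom S R F).flip x)

theorem balMk_zero_right (c : C) : balMk S R c (0 : F) = 0 :=
  map_zero (balMkHom S R F c)

@[elab_as_elim]
theorem balTensor_induction {p : BalTensor S R C F → Prop} (t : BalTensor S R C F)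
    (zero : p 0) (mk : ∀ c x, p (balMk S R c x)) (add : ∀ t t', p t → p t' → p (t + t')) : p t := by
  obtain ⟨t, rfl⟩ := Submodule.mkQ_surjective _ t
  induction t with
  | zero => rw [map_zero]; exact zero
  | tmul c x => exact mk c x
  | add t t' h h' => rw [map_add]; exact add _ _ h h'

theorem balTensor_addHom_ext {Z : Type*} [AddCommGroup Z] {f g : BalTensor S R C F →+ Z}
    (h : ∀ c x, f (balMk S R c x) = g (balMk S R c x)) : f = g :=
  AddMonoidHom.ext fun t => balTensor_induction t (by simp) h fun t t' ht ht' => by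
    rw [map_add, map_add, ht, ht']

theorem balTensor_linearMap_ext {Z : Type*} [AddCommGroup Z] [Module S Z]
    {f g : BalTensor S R C F →ₗ[S] Z} (h : ∀ c x, f (balMk S R c x) = g (balMk S R c x)) : f = g :=
  LinearMap.toAddMonoidHom_injective (balTensor_addHom_ext h)

/-- A spanning family of the right module `C` spans `C ⊗_R F` over `F`. -/
theorem exists_sum_balMk_eq {κ : Type*} [Fintype κ] (c : κ → C)
    (hc : ∀ y, ∃ r : κ → R, ∑ k, op (r k) • c k = y) (t : BalTensor S R C F) :
    ∃ x : κ → F, ∑ k, balMk S R (c k) (x k) = t := by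
  induction t using balTensor_induction with
  | zero => exact ⟨0, by simp [balMk_zero_right]⟩
  | mk y x =>
    obtain ⟨r, rfl⟩ := hc y
    exact ⟨fun k => r k • x, by simp only [balMk_sum_left, balMk_op_smul]⟩
  | add t t' h h' =>
    obtain ⟨x, rfl⟩ := h
    obtain ⟨x', rfl⟩ := h'
    exact ⟨x + x', by simp only [Pi.add_apply, balMk_add_right, Finset.sum_add_distrib]⟩

variable [SMulCommClass S Rᵐᵒᵖ C]

/-- The additive map out of `C ⊗_R F` induced by a balanced biadditive map. -/
def balLift {Z : Type*} [AddCommGroup Z] (φ : C →+ F →+ Z)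
    (h : ∀ c (r : R) x, φ (op r • c) x = φ c (r • x)) : BalTensor S R C F →+ Z :=
  QuotientAddGroup.lift (balancedRel S R C F).toAddSubgroup
    (TensorProduct.liftAddHom φ fun n c x => by simp) <| by
    intro t ht
    -- The relations form an S-span while the map is only additive, so the induction must carry all
    -- S-multiples of `t`.
    suffices H : ∀ s : S, TensorProduct.liftAddHom φ (fun n c x => by simp) (s • t) = 0 by
      simpa using H 1
    refine Submodule.span_induction (p := fun t _ => ∀ s : S,
      TensorProduct.liftAddHom φ (fun n c x => by simp) (s • t) = 0) ?_ ?_ ?_ ?_ ht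
    · rintro _ ⟨c, r, x, rfl⟩ s
      rw [smul_sub, TensorProduct.smul_tmul', TensorProduct.smul_tmul', map_sub,
        TensorProduct.liftAddHom_tmul, TensorProduct.liftAddHom_tmul, smul_comm, h, sub_self]
    · intro s
      rw [smul_zero, map_zero]
    · intro t t' _ _ ht ht' s
      rw [smul_add, map_add, ht, ht', add_zero]
    · intro s' t _ ht s
      rw [smul_smul, ht]

@[simp]
theorem balLift_balMk {Z : Type*} [AddCommGroup Z] (φ : C →+ F →+ Z)
    (h : ∀ c (r : R) x, φ (op r • c) x = φ c (r • x)) (c : C) (x : F) :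
    balLift (S := S) φ h (balMk S R c x) = φ c x :=
  rfl

/-- The linear map out of `C ⊗_R F` induced by a balanced map. -/
def balLiftLinear {Z : Type*} [AddCommGroup Z] [Module S Z] (φ : C →+ F →+ Z)
    (h : ∀ c (r : R) x, φ (op r • c) x = φ c (r • x))
    (hs : ∀ (s : S) c x, φ (s • c) x = s • φ c x) : BalTensor S R C F →ₗ[S] Z where
  __ := balLift φ h
  map_smul' s t := by
    change balLift (S := S) φ h (s • t) = s • balLift (S := S) φ h t
    induction t using balTensor_induction with
    | zero => simp
    | mk c x => rw [smul_balMk, balLift_balMk, balLift_balMk, hs]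
    | add t t' ht ht' => rw [smul_add, map_add, ht, ht', map_add, smul_add]

variable (S C) in
/-- The map `C ⊗_R F → C ⊗_R G` induced by `F → G`. -/
def balMapRight {G : Type*} [AddCommGroup G] [Module R G] (f : F →ₗ[R] G) :
    BalTensor S R C F →ₗ[S] BalTensor S R C G :=
  balLiftLinear (S := S) (R := R) (F := F) ((AddMonoidHom.compHom' f.toAddMonoidHom).comp (balMkHom S R G))
    (fun c r x => by
      change balMk S R (op r • c) (f x) = balMk S R c (f (r • x))
      rw [balMk_op_smul, map_smul])
    fun s c x => rfl

@[simp]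
theorem balMapRight_balMk {G : Type*} [AddCommGroup G] [Module R G] (f : F →ₗ[R] G) (c : C)
    (x : F) : balMapRight S C f (balMk S R c x) = balMk S R c (f x) :=
  rfl

end BalTensor

/-! ### Tensoring with a finitely generated free module -/

section Basis

variable {R : Type u} [Ring R] (F : Type u) [AddCommGroup F] [Module R F]
variable {P : Type u} [AddCommGroup P] [Module Rᵐᵒᵖ P] {ι : Type*} [Fintype ι]

/-- The group `P ⊗_R F` is a power of `F` if the right module `P` is free. -/
def balTensorEquivPi (b : Module.Basis ι Rᵐᵒᵖ P) : BalTensor ℤ R P F ≃+ (ι → F) where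
  __ := balLift (S := ℤ) (R := R) (C := P) (F := F) (Z := ι → F)
    (AddMonoidHom.mk' (fun p => AddMonoidHom.mk' (fun x i => (b.repr p i).unop • x)
      fun x y => funext fun i => smul_add _ _ _)
      fun p q => AddMonoidHom.ext fun x => funext fun i => by simp [add_smul])
    (fun p r x => funext fun i => by simp [mul_smul])
  invFun x := ∑ i, balMk ℤ R (b i) (x i)
  left_inv t := by
    induction t using balTensor_induction with
    | zero => simp [balMk_zero_right]
    | mk p x =>
      simp only [AddMonoidHom.toFun_eq_coe, balLift_balMk, AddMonoidHom.mk'_apply,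
        ← balMk_op_smul, op_unop]
      rw [← balMk_sum_left, b.sum_repr]
    | add t t' h h' =>
      refine Eq.trans ?_ (congrArg₂ (· + ·) h h')
      simp only [AddMonoidHom.toFun_eq_coe, map_add, Pi.add_apply, balMk_add_right,
        Finset.sum_add_distrib]
  right_inv x := by
    classical
    funext j
    simp [Finsupp.single_apply, Finset.sum_apply, apply_ite unop, ite_smul]

theorem balTensorEquivPi_symm_apply (b : Module.Basis ι Rᵐᵒᵖ P) (x : ι → F) :
    (balTensorEquivPi F b).symm x = ∑ i, balMk ℤ R (b i) (x i) :=
  rfl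

/-- By additivity it suffices to look at basis vectors tensored with elements of F, where the
coordinates of `f (b i)` appear as the columns of the matrix. -/
theorem balTensorEquivPi_balTensorMap {P' : Type u} [AddCommGroup P'] [Module Rᵐᵒᵖ P']
    {κ : Type*} [Fintype κ] (b : Module.Basis ι Rᵐᵒᵖ P) (b' : Module.Basis κ Rᵐᵒᵖ P')
    (f : P →ₗ[Rᵐᵒᵖ] P') (t : BalTensor ℤ R P F) :
    balTensorEquivPi F b' (balTensorMap F f t) =
      matrixAct (fun j i => (b'.repr (f (b i)) j).unop) (balTensorEquivPi F b t) := by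
  obtain ⟨x, rfl⟩ := (balTensorEquivPi F b).symm.surjective t
  rw [AddEquiv.apply_symm_apply, balTensorEquivPi_symm_apply, map_sum, map_sum]
  funext j
  rw [Finset.sum_apply]
  rfl

end Basis

/-! ### Weak injectivity and weak flatness as matrix conditions -/

section Resolution

variable (A : Type u) [Ring A]

/-- The pairs of matrices of the first two differentials of resolutions by finitely generated free
modules. -/
def resolutionPairs : Set (MatrixPair A) :=
  {p | ∃ (N : ModuleCat.{u} A) (Q : ProjectiveResolution N)
    (b₀ : Module.Basis p.a A (Q.complex.X 0)) (b₁ : Module.Basis p.b A (Q.complex.X 1))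
    (b₂ : Module.Basis p.c A (Q.complex.X 2)),
    (∀ n, Module.Finite A (Q.complex.X n)) ∧
    (p.fst = fun i j => b₀.repr ((Q.complex.d 1 0).hom (b₁ i)) j) ∧
    p.snd = fun i j => b₁.repr ((Q.complex.d 2 1).hom (b₂ i)) j}

variable {A}

theorem matrixAct_repr {ι κ : Type*} [Fintype κ] {P M : Type*} [AddCommGroup P] [Module A P]
    [AddCommGroup M] [Module A M] (b : Module.Basis κ A P) (v : ι → P) (φ : P →ₗ[A] M) :
    matrixAct (fun i j => b.repr (v i) j) (fun j => φ (b j)) = fun i => φ (v i) := by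
  funext i
  conv_rhs => rw [← b.sum_repr (v i), map_sum]
  simp [matrixAct]

/-- Columns over I are maps from the free terms of a resolution to I, and the matrices act by
composition with the differentials. Exactness at Hom(Q₁, I) says that a map on Q₁ killing the image
of Q₂, that is, a map on the first syzygy, extends to Q₀; this is Ext¹(N, I) = 0. -/
theorem weakInjective_iff (I : ModuleCat.{u} A) :
    WeakInjective A I ↔ ∀ p ∈ resolutionPairs A, p.Exact I := by
  constructor
  · rintro hI p ⟨N, Q, b₀, b₁, b₂, hQ, h₁, h₂⟩ y hy
    let d₁ := (Q.complex.d 1 0).hom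
    let d₂ := (Q.complex.d 2 1).hom
    let φ : Q.complex.X 1 →ₗ[A] I := b₁.constr ℕ y
    have hφb (j : p.b) : φ (b₁ j) = y j := b₁.constr_basis ℕ y j
    have hφ : φ ∘ₗ d₂ = 0 := by
      refine b₂.ext fun i => ?_
      have := congrFun (matrixAct_repr b₁ (fun i => d₂ (b₂ i)) φ) i
      simp only [hφb] at this
      rw [LinearMap.comp_apply, ← this, LinearMap.zero_apply]
      rw [h₂] at hy
      exact congrFun hy i
    have hker : LinearMap.ker d₁ ≤ LinearMap.ker φ := by
      intro x hx
      obtain ⟨z, rfl⟩ := (exact_resolution_d Q 0 x).1 hx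
      exact LinearMap.congr_fun hφ z
    -- Since `φ` kills ker d₁ it descends to the image of d₁, whose cokernel in Q₀ is N.
    obtain ⟨ψ, hψ⟩ := WeakInjective.exists_extension hI (LinearMap.range d₁).subtype
      (augmentation Q) (Submodule.injective_subtype _) (surjective_augmentation Q)
      (by
        rw [LinearMap.exact_iff, Submodule.range_subtype]
        exact LinearMap.exact_iff.1 (exact_augmentation Q)) ⟨Q, hQ⟩
      ((LinearMap.ker d₁).liftQ φ hker ∘ₗ d₁.quotKerEquivRange.symm.toLinearMap)
    have hψ' (x : Q.complex.X 1) : ψ (d₁ x) = φ x := by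
      refine (LinearMap.congr_fun hψ ⟨d₁ x, x, rfl⟩).trans ?_
      have : d₁.quotKerEquivRange.symm ⟨d₁ x, x, rfl⟩ = (LinearMap.ker d₁).mkQ x :=
        d₁.quotKerEquivRange.symm_apply_eq.2 rfl
      rw [LinearMap.comp_apply, LinearEquiv.coe_coe, this]
      exact (LinearMap.ker d₁).liftQ_apply φ x
    refine ⟨fun j => ψ (b₀ j), ?_⟩
    rw [h₁, matrixAct_repr]
    exact funext fun i => (hψ' (b₁ i)).trans (hφb i)
  · intro h N hN
    obtain ⟨Q, hQ⟩ := hN.exists_free_resolution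
    have := fun n => (hQ n).1
    have := fun n => (hQ n).2
    let b (n : ℕ) := Module.Free.chooseBasis A (Q.complex.X n)
    have : Module.Projective A (Q.complex.X 0) := .of_free
    refine subsingleton_ext_one_of_exists_extension (augmentation Q) (surjective_augmentation Q)
      fun φ => ?_
    let d₁ : Q.complex.X 1 →ₗ[A] LinearMap.ker (augmentation Q) :=
      (Q.complex.d 1 0).hom.codRestrict _ fun x => (exact_augmentation Q).apply_apply_eq_zero x
    obtain ⟨x, hx⟩ := h ⟨_, _, _, fun i j => (b 0).repr ((Q.complex.d 1 0).hom (b 1 i)) j,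
      fun i j => (b 1).repr ((Q.complex.d 2 1).hom (b 2 i)) j⟩
      ⟨N, Q, b 0, b 1, b 2, fun n => (hQ n).2, rfl, rfl⟩ (fun i => (φ ∘ₗ d₁) (b 1 i)) (by
        refine (matrixAct_repr _ _ _).trans (funext fun i => ?_)
        have : d₁ ((Q.complex.d 2 1).hom (b 2 i)) = 0 :=
          Subtype.ext ((exact_resolution_d Q 0).apply_apply_eq_zero _)
        rw [LinearMap.comp_apply, this, map_zero]
        rfl)
    let ψ : Q.complex.X 0 →ₗ[A] I := (b 0).constr ℕ x
    have hψ : ψ ∘ₗ (Q.complex.d 1 0).hom = φ ∘ₗ d₁ := by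
      refine (b 1).ext fun i => ?_
      refine Eq.trans ?_ (congrFun hx i)
      have := congrFun (matrixAct_repr (b 0) (fun i => (Q.complex.d 1 0).hom (b 1 i)) ψ) i
      refine this.symm.trans ?_
      congr 1
      exact funext fun j => (b 0).constr_basis ℕ x j
    refine ⟨ψ, LinearMap.ext ?_⟩
    rintro ⟨k, hk⟩
    obtain ⟨z, rfl⟩ := (exact_augmentation Q k).1 hk
    exact LinearMap.congr_fun hψ z

variable (A) in
theorem weakInjective_matrixDefinable : MatrixDefinable (WeakInjective A) :=
  ⟨resolutionPairs A, weakInjective_iff⟩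

/-- The transpose of a pair of matrices over the opposite ring. -/
def MatrixPair.flip {R : Type u} [Ring R] (p : MatrixPair Rᵐᵒᵖ) : MatrixPair R where
  a := p.c
  b := p.b
  c := p.a
  fst j i := (p.snd i j).unop
  snd k j := (p.fst j k).unop

/-- Tor₁ is the homology in degree 1 of the resolution tensored with F, and bases turn that complex
into powers of F with matrices as differentials. -/
theorem subsingleton_torGroup_one_iff {R : Type u} [Ring R] (F : Type u) [AddCommGroup F]
    [Module R F] {N : ModuleCat.{u} Rᵐᵒᵖ} (Q : ProjectiveResolution N) {a b c : Type*} [Fintype a]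
    [Fintype b] [Fintype c] (b₀ : Module.Basis a Rᵐᵒᵖ (Q.complex.X 0))
    (b₁ : Module.Basis b Rᵐᵒᵖ (Q.complex.X 1)) (b₂ : Module.Basis c Rᵐᵒᵖ (Q.complex.X 2)) :
    Subsingleton (TorGroup R F N 1) ↔ ∀ y : b → F,
      matrixAct (fun j i => (b₀.repr ((Q.complex.d 1 0).hom (b₁ i)) j).unop) y = 0 →
      ∃ x, matrixAct (fun j i => (b₁.repr ((Q.complex.d 2 1).hom (b₂ i)) j).unop) x = y := by
  let K := ((tensorFunctor R F).mapHomologicalComplex _).obj Q.complex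
  have e : TorGroup R F N 1 ≅ K.homology 1 := Q.isoLeftDerivedObj (tensorFunctor R F) 1
  have h : Subsingleton (TorGroup R F N 1) ↔ K.ExactAt 1 := by
    rw [K.exactAt_iff_isZero_homology, ← ModuleCat.isZero_iff_subsingleton]
    exact ⟨fun h => h.of_iso e.symm, fun h => h.of_iso e⟩
  rw [h, K.exactAt_iff' 2 1 0 (by simp) (by simp), ShortComplex.moduleCat_exact_iff]
  change (∀ t : BalTensor ℤ R (Q.complex.X 1) F, balTensorMap F (Q.complex.d 1 0).hom t = 0 →
    ∃ s, balTensorMap F (Q.complex.d 2 1).hom s = t) ↔ _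
  have hd₁ := balTensorEquivPi_balTensorMap F b₁ b₀ (Q.complex.d 1 0).hom
  have hd₂ := balTensorEquivPi_balTensorMap F b₂ b₁ (Q.complex.d 2 1).hom
  constructor
  · intro H y hy
    obtain ⟨s, hs⟩ := H ((balTensorEquivPi F b₁).symm y) (by
      apply (balTensorEquivPi F b₀).injective
      rw [hd₁, AddEquiv.apply_symm_apply, map_zero]
      exact hy)
    exact ⟨balTensorEquivPi F b₂ s, by rw [← hd₂, hs, AddEquiv.apply_symm_apply]⟩
  · intro H t ht
    obtain ⟨x, hx⟩ := H (balTensorEquivPi F b₁ t) (by rw [← hd₁, ht, map_zero])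
    refine ⟨(balTensorEquivPi F b₂).symm x, (balTensorEquivPi F b₁).injective ?_⟩
    rw [hd₂, AddEquiv.apply_symm_apply, hx]

theorem weakFlat_iff {R : Type u} [Ring R] (F : ModuleCat.{u} R) :
    WeakFlat R F ↔ ∀ p ∈ resolutionPairs Rᵐᵒᵖ, p.flip.Exact F := by
  constructor
  · rintro hF p ⟨N, Q, b₀, b₁, b₂, hQ, h₁, h₂⟩
    change ∀ y : p.b → F, matrixAct (fun j i => (p.fst i j).unop) y = 0 →
      ∃ x : p.c → F, matrixAct (fun j i => (p.snd i j).unop) x = y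
    rw [h₁, h₂]
    exact (subsingleton_torGroup_one_iff F Q b₀ b₁ b₂).1 (hF N ⟨Q, hQ⟩)
  · intro h N hN
    obtain ⟨Q, hQ⟩ := hN.exists_free_resolution
    have := fun n => (hQ n).1
    have := fun n => (hQ n).2
    let b (n : ℕ) := Module.Free.chooseBasis Rᵐᵒᵖ (Q.complex.X n)
    exact (subsingleton_torGroup_one_iff F Q (b 0) (b 1) (b 2)).2
      (h ⟨_, _, _, fun i j => (b 0).repr ((Q.complex.d 1 0).hom (b 1 i)) j,
        fun i j => (b 1).repr ((Q.complex.d 2 1).hom (b 2 i)) j⟩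
        ⟨N, Q, b 0, b 1, b 2, fun n => (hQ n).2, rfl, rfl⟩)

theorem weakFlat_matrixDefinable (R : Type u) [Ring R] : MatrixDefinable (WeakFlat R) :=
  ⟨MatrixPair.flip '' resolutionPairs Rᵐᵒᵖ, fun F => by simp [weakFlat_iff]⟩

end Resolution

/-! ### Character modules -/

section Character

/-- The character descends to G / ker f, which embeds in H, and ℚ/ℤ is injective. -/
theorem exists_character_comp_eq {G H : Type*} [AddCommGroup G] [AddCommGroup H] (f : G →+ H)
    (y : CharacterModule G) (h : ∀ g, f g = 0 → y g = 0) :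
    ∃ x : CharacterModule H, ∀ g, x (f g) = y g := by
  let k : G ⧸ f.ker →ₗ[ℤ] H := (QuotientAddGroup.kerLift f).toIntLinearMap
  let y' : CharacterModule (G ⧸ f.ker) := QuotientAddGroup.lift f.ker y fun g hg => h g hg
  obtain ⟨x, hx⟩ := CharacterModule.dual_surjective_of_injective k
    (QuotientAddGroup.kerLift_injective f) y'
  exact ⟨x, fun g => DFunLike.congr_fun hx (QuotientAddGroup.mk g : G ⧸ f.ker)⟩

theorem exists_character_of_notMem {G : Type*} [AddCommGroup G] (H : AddSubgroup G) {t : G}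
    (ht : t ∉ H) : ∃ x : CharacterModule G, (∀ g ∈ H, x g = 0) ∧ x t ≠ 0 := by
  obtain ⟨x, hx⟩ := CharacterModule.exists_character_apply_ne_zero_of_ne_zero
    (a := (QuotientAddGroup.mk t : G ⧸ H)) (by rwa [Ne, QuotientAddGroup.eq_zero_iff])
  refine ⟨AddMonoidHom.comp x (QuotientAddGroup.mk' H), fun g hg => ?_, hx⟩
  change x (QuotientAddGroup.mk g) = 0
  rw [(QuotientAddGroup.eq_zero_iff g).2 hg, map_zero]

variable (R : Type*) (F : Type*) [AddCommGroup F]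

/-- The group of characters of a left module, as a right module. -/
def CharDual (_R : Type*) (F : Type*) [AddCommGroup F] : Type _ := F →+ AddCircle (1 : ℚ)

instance : AddCommGroup (CharDual R F) :=
  inferInstanceAs (AddCommGroup (F →+ AddCircle (1 : ℚ)))

instance : FunLike (CharDual R F) F (AddCircle (1 : ℚ)) :=
  inferInstanceAs (FunLike (F →+ AddCircle (1 : ℚ)) F (AddCircle (1 : ℚ)))

instance : AddMonoidHomClass (CharDual R F) F (AddCircle (1 : ℚ)) :=
  inferInstanceAs (AddMonoidHomClass (F →+ AddCircle (1 : ℚ)) F (AddCircle (1 : ℚ)))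

variable {R F} in
theorem CharDual.ext {χ ψ : CharDual R F} (h : ∀ x, χ x = ψ x) : χ = ψ :=
  DFunLike.ext _ _ h

variable {R F} in
theorem CharDual.sum_apply {κ : Type*} (s : Finset κ) (χ : κ → CharDual R F) (x : F) :
    (∑ k ∈ s, χ k) x = ∑ k ∈ s, χ k x :=
  AddMonoidHom.finsetSum_apply (M := F) (N := AddCircle (1 : ℚ)) χ s x

variable [Ring R] [Module R F]

instance : Module Rᵐᵒᵖ (CharDual R F) where
  smul r := fun (χ : F →+ AddCircle (1 : ℚ)) => χ.comp (DistribSMul.toAddMonoidHom F r.unop)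
  one_smul := fun (χ : F →+ AddCircle (1 : ℚ)) => AddMonoidHom.ext fun x =>
    congrArg χ (one_smul R x)
  mul_smul r r' := fun (χ : F →+ AddCircle (1 : ℚ)) => AddMonoidHom.ext fun x =>
    congrArg χ (mul_smul r'.unop r.unop x)
  smul_zero _ := rfl
  smul_add _ _ _ := rfl
  add_smul r r' := fun (χ : F →+ AddCircle (1 : ℚ)) => AddMonoidHom.ext fun x =>
    (congrArg χ (add_smul r.unop r'.unop x)).trans (χ.map_add _ _)
  zero_smul := fun (χ : F →+ AddCircle (1 : ℚ)) => AddMonoidHom.ext fun x =>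
    (congrArg χ (zero_smul R x)).trans χ.map_zero

end Character

section

variable {R : Type u} [Ring R] {F : Type u} [AddCommGroup F] [Module R F]

/-- Taking characters reverses arrows and preserves exactness. A column of characters is a character
`Y` of a power of F, and the transposed matrices act on characters by composition. -/
theorem MatrixPair.Exact.charDual {p : MatrixPair Rᵐᵒᵖ} (h : p.flip.Exact F) :
    p.Exact (CharDual R F) := by
  classical
  intro y hy
  let T : (p.b → F) →+ (p.a → F) :=
    AddMonoidHom.mk' (fun x k => ∑ j, (p.fst j k).unop • x j) fun x x' => by
      funext k
      simp [Finset.sum_add_distrib]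
  let Y : (p.b → F) →+ AddCircle (1 : ℚ) :=
    AddMonoidHom.mk' (fun v => ∑ j, y j (v j)) fun x x' => by
      simp [Finset.sum_add_distrib]
  have hY (j : p.b) (v : F) : Y (Pi.single j v) = y j v := by
    refine (Finset.sum_eq_single j (fun k _ hk => ?_) (by simp)).trans ?_
    · rw [Pi.single_eq_of_ne hk, map_zero]
    · rw [Pi.single_eq_same]
  -- By exactness over F, the kernel of `T` is the image of the other matrix, and `hy` says that `Y`
  -- vanishes there; so `Y` factors through `T`.
  obtain ⟨X, hX⟩ := exists_character_comp_eq T Y fun v hv => by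
    obtain ⟨w, rfl⟩ := h v hv
    have (i : p.c) : ∑ j, y j ((p.snd i j).unop • w i) = 0 := by
      have := congrArg (fun χ : CharDual R F => χ (w i)) (congrFun hy i)
      exact (CharDual.sum_apply _ _ _).symm.trans this
    change ∑ j, y j (∑ i, (p.snd i j).unop • w i) = 0
    simp only [map_sum]
    rw [Finset.sum_comm]
    exact Finset.sum_eq_zero fun i _ => this i
  refine ⟨fun k => (AddMonoidHom.comp X (AddMonoidHom.single (fun _ : p.a => F) k) : F →+ _), ?_⟩
  funext j
  refine CharDual.ext fun v => ?_
  refine (CharDual.sum_apply _ _ _).trans ?_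
  refine Eq.trans ?_ ((hX (Pi.single j v)).trans (hY j v))
  change ∑ k, X (Pi.single k ((p.fst j k).unop • v)) = _
  rw [← map_sum]
  congr 1
  funext k
  rw [Finset.sum_apply, Finset.sum_eq_single k, Pi.single_eq_same]
  · refine Eq.trans ?_ (Finset.sum_eq_single j ?_ (by simp)).symm
    · rw [Pi.single_eq_same]
    · intro i _ hi
      rw [Pi.single_eq_of_ne hi, smul_zero]
  · intro i _ hi
    rw [Pi.single_eq_of_ne hi.symm]
  · simp

theorem WeakFlat.weakInjective_charDual (hF : WeakFlat R (ModuleCat.of R F)) :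
    WeakInjective Rᵐᵒᵖ (ModuleCat.of Rᵐᵒᵖ (CharDual R F)) :=
  (weakInjective_iff _).2 fun p hp => ((weakFlat_iff _).1 hF p hp).charDual

end

/-! ### Finite presentations by generators and relations -/

section Presentation

/-- A finite presentation of a module by generators and relations. -/
structure FinPresentation (A : Type*) [Ring A] (C : Type*) [AddCommGroup C] [Module A C] where
  (n m : ℕ)
  /-- the generators -/
  gen : Fin n → C
  /-- the relations -/
  rel : Fin m → Fin n → A
  exists_sum_gen : ∀ c, ∃ a : Fin n → A, ∑ k, a k • gen k = c
  rel_gen : ∀ j, ∑ k, rel j k • gen k = 0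
  exists_sum_rel : ∀ a : Fin n → A, ∑ k, a k • gen k = 0 →
    ∃ b : Fin m → A, ∀ k, ∑ j, b j * rel j k = a k

variable {A : Type*} [Ring A] {C : Type*} [AddCommGroup C] [Module A C]

theorem FinPresentation.exists_hom (P : FinPresentation A C) {N : Type*} [AddCommGroup N]
    [Module A N] (g : Fin P.n → N) (hg : ∀ j, ∑ k, P.rel j k • g k = 0) :
    ∃ φ : C →ₗ[A] N, ∀ k, φ (P.gen k) = g k := by
  let p := Fintype.linearCombination A P.gen
  let q := Fintype.linearCombination A g
  have hp : Function.Surjective p := P.exists_sum_gen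
  have hpq : LinearMap.ker p ≤ LinearMap.ker q := by
    intro a ha
    obtain ⟨b, hb⟩ := P.exists_sum_rel a ha
    rw [LinearMap.mem_ker, Fintype.linearCombination_apply]
    simp only [← hb, Finset.sum_smul, mul_smul]
    rw [Finset.sum_comm]
    simp only [← Finset.smul_sum, hg, smul_zero, Finset.sum_const_zero]
  refine ⟨(LinearMap.ker p).liftQ q hpq ∘ₗ (p.quotKerEquivOfSurjective hp).symm.toLinearMap,
    fun k => ?_⟩
  have : (p.quotKerEquivOfSurjective hp).symm (P.gen k) =
      (LinearMap.ker p).mkQ (Pi.single k 1) := by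
    rw [LinearEquiv.symm_apply_eq]
    simp [p]
  rw [LinearMap.comp_apply, LinearEquiv.coe_coe, this, Submodule.mkQ_apply, Submodule.liftQ_apply]
  simp [q]

theorem FinPresentation.hom_ext (P : FinPresentation A C) {N : Type*} [AddCommGroup N]
    [Module A N] {f g : C →ₗ[A] N} (h : ∀ k, f (P.gen k) = g (P.gen k)) : f = g := by
  ext c
  obtain ⟨a, rfl⟩ := P.exists_sum_gen c
  simp [h]

theorem nonempty_finPresentation_of_finitePresentation [Module.FinitePresentation A C] :
    Nonempty (FinPresentation A C) := by
  obtain ⟨n, p, hp⟩ := Module.Finite.exists_fin' A C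
  obtain ⟨m, s, hs⟩ := Submodule.fg_iff_exists_fin_generating_family.1
    (Module.FinitePresentation.fg_ker p hp)
  have hp' (a : Fin n → A) : ∑ k, a k • p (Pi.single k 1) = p a := by
    simp only [← map_smul, ← map_sum]
    congr 1
    funext k
    simp [Finset.sum_apply, Pi.single_apply]
  refine ⟨⟨n, m, fun k => p (Pi.single k 1), s, fun c => ?_, fun j => ?_, fun a ha => ?_⟩⟩
  · obtain ⟨a, rfl⟩ := hp c
    exact ⟨a, hp' a⟩
  · rw [hp']
    have : s j ∈ LinearMap.ker p := hs ▸ Submodule.subset_span ⟨j, rfl⟩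
    exact this
  · rw [hp'] at ha
    have : a ∈ Submodule.span A (Set.range s) := hs ▸ ha
    obtain ⟨b, rfl⟩ := (Submodule.mem_span_range_iff_exists_fun A).1 this
    exact ⟨b, fun k => by simp⟩

theorem SuperFinitelyPresented.nonempty_finPresentation {A C : Type u} [Ring A] [AddCommGroup C]
    [Module A C] (h : SuperFinitelyPresented A (ModuleCat.of A C)) :
    Nonempty (FinPresentation A C) := by
  obtain ⟨Q, f, _, _, hf, hker⟩ := freeResolving_superFinitelyPresented A _ h
  have : Module.FinitePresentation A C :=
    Module.finitePresentation_of_free_of_surjective f hf (Module.Finite.iff_fg.1 hker.finite)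
  exact nonempty_finPresentation_of_finitePresentation

end Presentation

theorem linearMap_sum_map_single {A ι M N : Type*} [Ring A] [Fintype ι] [DecidableEq ι]
    [AddCommGroup M] [Module A M] [AddCommGroup N] [Module A N] (f : (ι → M) →ₗ[A] N) (x : ι → M) :
    ∑ i, f (Pi.single i (x i)) = f x := by
  rw [← map_sum, LinearMap.sum_single_apply]

/-! ### The exact sequence behind the evaluation map -/

section Extension

variable {A : Type u} [Ring A] {I : Type u} [AddCommGroup I] [Module A I]
  {X Y Z : Type u} [AddCommGroup X] [Module A X] [AddCommGroup Y] [Module A Y] [AddCommGroup Z]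
  [Module A Z]

/-- If `0 → X → Y → Z` is an exact sequence of super finitely presented modules and `I` is weak
injective, then `Hom(Z, I) → Hom(Y, I) → Hom(X, I) → 0` is exact. -/
theorem WeakInjective.hom_exact (hI : WeakInjective A (ModuleCat.of A I)) {f : X →ₗ[A] Y}
    {g : Y →ₗ[A] Z} (hf : Function.Injective f) (hfg : Function.Exact f g)
    (hX : SuperFinitelyPresented A (ModuleCat.of A X))
    (hY : SuperFinitelyPresented A (ModuleCat.of A Y))
    (hZ : SuperFinitelyPresented A (ModuleCat.of A Z)) :
    (∀ φ : X →ₗ[A] I, ∃ ψ : Y →ₗ[A] I, ψ ∘ₗ f = φ) ∧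
      ∀ φ : Y →ₗ[A] I, φ ∘ₗ f = 0 → ∃ ψ : Z →ₗ[A] I, ψ ∘ₗ g = φ := by
  have hex : Function.Exact f g.rangeRestrict := by
    rw [LinearMap.exact_iff, LinearMap.ker_rangeRestrict]
    exact LinearMap.exact_iff.1 hfg
  have hg := g.surjective_rangeRestrict
  -- Extending maps along X → Y and along im g → Z requires the cokernels im g and Z / im g to be
  -- super finitely presented.
  have hrange := hX.of_coker f g.rangeRestrict hf hg hex hY
  have hquot := hrange.of_coker (LinearMap.range g).subtype (LinearMap.range g).mkQ
    (Submodule.injective_subtype _) (Submodule.mkQ_surjective _)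
    (LinearMap.exact_subtype_mkQ _) hZ
  refine ⟨fun φ => hI.exists_extension f g.rangeRestrict hf hg hex hrange φ, fun φ hφ => ?_⟩
  have hker : LinearMap.ker g ≤ LinearMap.ker φ := by
    rw [LinearMap.exact_iff.1 hfg]
    rintro _ ⟨x, rfl⟩
    exact LinearMap.congr_fun hφ x
  obtain ⟨ψ, hψ⟩ := hI.exists_extension (LinearMap.range g).subtype (LinearMap.range g).mkQ
    (Submodule.injective_subtype _) (Submodule.mkQ_surjective _)
    (LinearMap.exact_subtype_mkQ _) hquot
    ((LinearMap.ker g).liftQ φ hker ∘ₗ g.quotKerEquivRange.symm.toLinearMap)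
  refine ⟨ψ, LinearMap.ext fun y => (LinearMap.congr_fun hψ ⟨g y, y, rfl⟩).trans ?_⟩
  have : g.quotKerEquivRange.symm ⟨g y, y, rfl⟩ = (LinearMap.ker g).mkQ y :=
    g.quotKerEquivRange.symm_apply_eq.2 rfl
  rw [LinearMap.comp_apply, LinearEquiv.coe_coe, this]
  exact (LinearMap.ker g).liftQ_apply φ y

variable {B : Type u} [Ring B] {C : Type u} [AddCommGroup C] [Module A C] [Module B C]
  [SMulCommClass A B C]

/-- Let `C` have commuting actions of `A` and `B`, super finitely presented over `A` and presented
over `B`, with `A` the ring of `B`-linear endomorphisms of `C`. Then the evaluation map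
`C ⊗ Hom_A(C, I) → I` is bijective for every weak injective `A`-module `I`; this is stated in terms
of the presentation. -/
theorem WeakInjective.evaluation_exact (hI : WeakInjective A (ModuleCat.of A I))
    (hC : SuperFinitelyPresented A (ModuleCat.of A C)) (P : FinPresentation B C)
    (hinj : ∀ a : A, (∀ c : C, a • c = 0) → a = 0)
    (hsurj : ∀ φ : C →ₗ[B] C, ∃ a : A, ∀ c, a • c = φ c) :
    (∀ y : I, ∃ φ : Fin P.n → C →ₗ[A] I, ∑ k, φ k (P.gen k) = y) ∧
      ∀ φ : Fin P.n → C →ₗ[A] I, ∑ k, φ k (P.gen k) = 0 →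
        ∃ ψ : Fin P.m → C →ₗ[A] I, ∀ k x, φ k x = ∑ j, ψ j (P.rel j k • x) := by
  -- The maps `f` and `g` come from applying Hom_B(-, C) to Bᵐ → Bⁿ → C → 0, with End_B(C)
  -- identified with A. A tuple killed by all relations is an endomorphism of C, that is, a scalar
  -- from A.
  let f : A →ₗ[A] Fin P.n → C := LinearMap.pi fun k => LinearMap.toSpanSingleton A C (P.gen k)
  let g : (Fin P.n → C) →ₗ[A] Fin P.m → C :=
    { toFun := fun x j => ∑ k, P.rel j k • x k
      map_add' := fun x y => funext fun j => by simp [Finset.sum_add_distrib]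
      map_smul' := fun a x => funext fun j => by
        simp [Finset.smul_sum, smul_comm a] }
  have hf : Function.Injective f := by
    refine (injective_iff_map_eq_zero f).2 fun a ha => hinj a fun c => ?_
    obtain ⟨b, rfl⟩ := P.exists_sum_gen c
    rw [Finset.smul_sum]
    refine Finset.sum_eq_zero fun k _ => ?_
    rw [smul_comm]
    have : a • P.gen k = 0 := congrFun ha k
    rw [this, smul_zero]
  have hfg : Function.Exact f g := by
    intro x
    constructor
    · intro hx
      obtain ⟨φ, hφ⟩ := P.exists_hom x fun j => congrFun hx j
      obtain ⟨a, ha⟩ := hsurj φ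
      exact ⟨a, funext fun k => (ha _).trans (hφ k)⟩
    · rintro ⟨a, rfl⟩
      funext j
      change ∑ k, P.rel j k • a • P.gen k = 0
      simp only [← smul_comm a]
      rw [← Finset.smul_sum, P.rel_gen, smul_zero]
  obtain ⟨h₁, h₂⟩ := hI.hom_exact hf hfg (.of_free A) (hC.pi _) (hC.pi _)
  constructor
  · intro y
    -- Extend the map 1 ↦ `y` from A to Cⁿ; its components evaluated at the generators add up to
    -- `y`.
    obtain ⟨Φ, hΦ⟩ := h₁ (LinearMap.toSpanSingleton A I y)
    refine ⟨fun k => Φ ∘ₗ LinearMap.single A (fun _ => C) k, ?_⟩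
    have := LinearMap.congr_fun hΦ 1
    rw [LinearMap.toSpanSingleton_apply, one_smul] at this
    rw [← this]
    refine (linearMap_sum_map_single Φ P.gen).trans ?_
    exact congrArg Φ (funext fun k => (one_smul A (P.gen k)).symm)
  · intro φ hφ
    -- The hypothesis says that the assembled map Cⁿ → I kills the image of 1 ∈ A, so it factors
    -- through the relation map `g`.
    obtain ⟨Ψ, hΨ⟩ := h₂ (∑ k, φ k ∘ₗ LinearMap.proj k) (by
      refine LinearMap.ext_ring ?_
      simpa [f] using hφ)
    refine ⟨fun j => Ψ ∘ₗ LinearMap.single A (fun _ => C) j, fun k x => ?_⟩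
    have hk : (∑ k, φ k ∘ₗ LinearMap.proj k : (Fin P.n → C) →ₗ[A] I) (Pi.single k x) = φ k x := by
      rw [LinearMap.sum_apply, Finset.sum_eq_single k]
      · simp
      · intro l _ hl
        simp [Pi.single_eq_of_ne hl]
      · simp
    have hg : g (Pi.single k x) = fun j => P.rel j k • x := by
      funext j
      refine (Finset.sum_eq_single k (fun l _ hl => ?_)
        fun h => absurd (Finset.mem_univ k) h).trans ?_
      · rw [Pi.single_eq_of_ne hl, smul_zero]
      · rw [Pi.single_eq_same]
    rw [← hk, ← hΨ, LinearMap.comp_apply, hg]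
    exact (linearMap_sum_map_single Ψ _).symm

end Extension

/-! ### The adjunction between C ⊗_R - and Hom_S(C, -) -/

section BimodHom

variable {S R C N : Type u} [Ring S] [AddCommGroup C] [Module S C] [AddCommGroup N] [Module S N]

/-- An element of `Hom_S(C, N)` as a linear map. -/
def BimodHom.toHom (φ : BimodHom S C N R) : C →ₗ[S] N := φ

/-- A linear map as an element of `Hom_S(C, N)`. -/
def BimodHom.ofHom (φ : C →ₗ[S] N) : BimodHom S C N R := φ

theorem BimodHom.ext {φ ψ : BimodHom S C N R} (h : ∀ c, φ.toHom c = ψ.toHom c) : φ = ψ :=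
  LinearMap.ext (f := φ.toHom) (g := ψ.toHom) h

theorem BimodHom.sum_toHom {κ : Type*} (s : Finset κ) (φ : κ → BimodHom S C N R) (c : C) :
    (∑ k ∈ s, φ k).toHom c = ∑ k ∈ s, (φ k).toHom c :=
  LinearMap.sum_apply s (fun k => (φ k).toHom) c

end BimodHom

section Adjunction

variable {S R : Type u} [Ring S] [Ring R]
variable {C : Type u} [AddCommGroup C] [Module S C] [Module Rᵐᵒᵖ C] [SMulCommClass S Rᵐᵒᵖ C]
variable {N N' : Type u} [AddCommGroup N] [Module S N] [AddCommGroup N'] [Module S N']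
variable {M M' : Type u} [AddCommGroup M] [Module R M] [AddCommGroup M'] [Module R M']

variable (R C) in
/-- The map `Hom_S(C, N) → Hom_S(C, N')` induced by `N → N'`. -/
def bimodMap (f : N →ₗ[S] N') : BimodHom S C N R →ₗ[R] BimodHom S C N' R where
  toFun φ := BimodHom.ofHom (f ∘ₗ φ.toHom)
  map_add' φ ψ := LinearMap.comp_add φ.toHom ψ.toHom f
  map_smul' _ _ := rfl

@[simp]
theorem bimodMap_toHom (f : N →ₗ[S] N') (φ : BimodHom S C N R) (c : C) :
    (bimodMap R C f φ).toHom c = f (φ.toHom c) :=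
  rfl

variable (S R C N) in
/-- The evaluation map `C ⊗_R Hom_S(C, N) → N`. -/
def evalMap : BalTensor S R C (BimodHom S C N R) →ₗ[S] N :=
  balLiftLinear (S := S) (R := R) (C := C) (F := BimodHom S C N R) (Z := N)
    (AddMonoidHom.mk' (fun c => AddMonoidHom.mk' (fun φ => φ.toHom c) fun _ _ => rfl)
      fun c c' => AddMonoidHom.ext fun φ => map_add φ.toHom c c')
    (fun _ _ _ => rfl) fun s c φ => map_smul φ.toHom s c

@[simp]
theorem evalMap_balMk (c : C) (φ : BimodHom S C N R) :
    evalMap S R C N (balMk S R c φ) = φ.toHom c :=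
  rfl

variable (S R C M) in
/-- The coevaluation map `M → Hom_S(C, C ⊗_R M)`. -/
def coevMap : M →ₗ[R] BimodHom S C (BalTensor S R C M) R where
  toFun x := BimodHom.ofHom
    { toFun := fun c => balMk S R c x
      map_add' := fun c c' => balMk_add_left c c' x
      map_smul' := fun _ _ => rfl }
  map_add' x x' := BimodHom.ext fun c => balMk_add_right c x x'
  map_smul' r x := BimodHom.ext fun c => (balMk_op_smul r c x).symm

@[simp]
theorem coevMap_toHom (x : M) (c : C) : (coevMap S R C M x).toHom c = balMk S R c x :=
  rfl

theorem evalMap_naturality (f : N →ₗ[S] N') (t : BalTensor S R C (BimodHom S C N R)) :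
    evalMap S R C N' (balMapRight S C (bimodMap R C f) t) = f (evalMap S R C N t) := by
  induction t using balTensor_induction with
  | zero => simp
  | mk c x => simp
  | add t t' h h' => rw [map_add, map_add, map_add, map_add, h, h']

theorem coevMap_naturality (f : M →ₗ[R] M') (x : M) :
    coevMap S R C M' (f x) = bimodMap R C (balMapRight S C f) (coevMap S R C M x) :=
  BimodHom.ext fun c => by simp

theorem balMapRight_comp {M'' : Type u} [AddCommGroup M''] [Module R M''] (g : M' →ₗ[R] M'')
    (f : M →ₗ[R] M') (t : BalTensor S R C M) :
    balMapRight S C g (balMapRight S C f t) = balMapRight S C (g ∘ₗ f) t := by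
  induction t using balTensor_induction with
  | zero => simp
  | mk c x => simp
  | add t t' h h' => simp only [map_add, h, h']

theorem balMapRight_id (t : BalTensor S R C M) : balMapRight S C (LinearMap.id : M →ₗ[R] M) t = t := by
  induction t using balTensor_induction with
  | zero => simp
  | mk c x => simp
  | add t t' h h' => simp only [map_add, h, h']

theorem bijective_balMapRight (e : M ≃ₗ[R] M') :
    Function.Bijective (balMapRight S C e.toLinearMap) := by
  refine Function.bijective_iff_has_inverse.2 ⟨balMapRight S C e.symm.toLinearMap, fun t => ?_,
    fun t => ?_⟩
  · rw [balMapRight_comp, LinearEquiv.symm_comp, balMapRight_id]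
  · rw [balMapRight_comp, LinearEquiv.comp_symm, balMapRight_id]

theorem bijective_bimodMap {f : N →ₗ[S] N'} (hf : Function.Bijective f) :
    Function.Bijective (bimodMap R C f) := by
  let e := LinearEquiv.ofBijective f hf
  refine Function.bijective_iff_has_inverse.2 ⟨bimodMap R C e.symm.toLinearMap, fun φ => ?_,
    fun φ => ?_⟩
  · exact BimodHom.ext fun c => e.symm_apply_apply _
  · exact BimodHom.ext fun c => e.apply_symm_apply _

end Adjunction

/-! ### Bijectivity of evaluation and coevaluation, and intrinsic descriptions of the two classes -/

section Bijective

variable {S R : Type u} [Ring S] [Ring R]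
variable {C : Type u} [AddCommGroup C] [Module S C] [Module Rᵐᵒᵖ C] [SMulCommClass S Rᵐᵒᵖ C]

/-- Weak injective modules belong to the Bass class of a semidualizing bimodule. -/
theorem bijective_evalMap (hC : Semidualizing S R C) {I : Type u} [AddCommGroup I] [Module S I]
    (hI : WeakInjective S (ModuleCat.of S I)) : Function.Bijective (evalMap S R C I) := by
  obtain ⟨P⟩ := hC.a2.nonempty_finPresentation
  obtain ⟨h₁, h₂⟩ := hI.evaluation_exact hC.a1 P
    (fun s hs => hC.b1.1 (LinearMap.ext fun c => (hs c).trans (zero_smul S c).symm))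
    fun φ => (hC.b1.2 φ).imp fun s hs c => LinearMap.congr_fun hs c
  constructor
  · refine (injective_iff_map_eq_zero _).2 fun t ht => ?_
    obtain ⟨φ, rfl⟩ := exists_sum_balMk_eq (S := S) (R := R) P.gen
      (fun y => have ⟨a, ha⟩ := P.exists_sum_gen y; ⟨fun k => (a k).unop, ha⟩) t
    rw [map_sum] at ht
    -- The `φ k` are combinations of the `ψ j` with the relations as coefficients; moving these
    -- across the tensor sign leaves relations among the generators, which vanish.
    obtain ⟨ψ, hψ⟩ := h₂ (fun k => (φ k).toHom) ht
    have hφ (k : Fin P.n) : φ k = ∑ j, (P.rel j k).unop • BimodHom.ofHom (ψ j) :=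
      BimodHom.ext fun c => by
        rw [BimodHom.sum_toHom]
        exact hψ k c
    simp only [hφ, balMk_sum_right, ← balMk_op_smul, op_unop]
    rw [Finset.sum_comm]
    refine Finset.sum_eq_zero fun j _ => ?_
    rw [← balMk_sum_left, P.rel_gen, balMk_zero_left]
  · intro y
    obtain ⟨φ, hφ⟩ := h₁ y
    exact ⟨∑ k, balMk S R (P.gen k) (BimodHom.ofHom (φ k)), (map_sum _ _ _).trans hφ⟩

variable (S) in
/-- The character of `C ⊗_R F` induced by a map from `C` to the character module of `F`. -/
def charLift {F : Type u} [AddCommGroup F] [Module R F] (φ : C →ₗ[Rᵐᵒᵖ] CharDual R F) :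
    BalTensor S R C F →+ AddCircle (1 : ℚ) :=
  balLift (S := S) (R := R) (C := C) (F := F) φ.toAddMonoidHom fun c r x => by
    change φ (op r • c) x = φ c (r • x)
    rw [map_smul]
    rfl

theorem charLift_balMk {F : Type u} [AddCommGroup F] [Module R F] (φ : C →ₗ[Rᵐᵒᵖ] CharDual R F)
    (c : C) (x : F) : charLift S φ (balMk S R c x) = φ c x :=
  rfl

/-- The map from `C` to the character module of `F` given by a character of `C ⊗_R F`. -/
def charCurry {F : Type u} [AddCommGroup F] [Module R F]
    (χ : BalTensor S R C F →+ AddCircle (1 : ℚ)) : C →ₗ[Rᵐᵒᵖ] CharDual R F where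
  toFun c := AddMonoidHom.comp χ (balMkHom S R F c)
  map_add' c c' := by rw [map_add]; exact AddMonoidHom.comp_add _ _ _
  map_smul' r c := CharDual.ext fun x => congrArg χ (balMk_op_smul r.unop c x)

theorem addMonoidHom_sum_map_single {ι M N : Type*} [Fintype ι] [DecidableEq ι]
    [AddCommGroup M] [AddCommGroup N] (f : (ι → M) →+ N) (x : ι → M) :
    ∑ i, f (Pi.single i (x i)) = f x := by
  rw [← map_sum, Finset.univ_sum_single]

/-- Weak flat modules belong to the Auslander class of a semidualizing bimodule. -/
theorem bijective_coevMap (hC : Semidualizing S R C) {F : Type u} [AddCommGroup F] [Module R F]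
    (hF : WeakFlat R (ModuleCat.of R F)) : Function.Bijective (coevMap S R C F) := by
  obtain ⟨P⟩ := hC.a1.nonempty_finPresentation
  have := SMulCommClass.symm S Rᵐᵒᵖ C
  obtain ⟨h₁, h₂⟩ := hF.weakInjective_charDual.evaluation_exact hC.a2 P
    (fun r hr => unop_injective (hC.b2.1 (LinearMap.ext fun c =>
      (hr c).trans (zero_smul Rᵐᵒᵖ c).symm)))
    fun φ => (hC.b2.2 φ).imp' op fun r hr c => LinearMap.congr_fun hr c
  constructor
  · refine (injective_iff_map_eq_zero _).2 fun x hx => ?_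
    by_contra hne
    obtain ⟨χ, hχ⟩ := CharacterModule.exists_character_apply_ne_zero_of_ne_zero hne
    -- A character of F is a sum of values `φ k (P.gen k)`, so its value at `x` is computed by
    -- characters of C ⊗_R F at the elements `P.gen k` ⊗ x, all zero here.
    obtain ⟨φ, hφ⟩ := h₁ χ
    have h : ∑ k, φ k (P.gen k) x = χ x :=
      (CharDual.sum_apply _ _ _).symm.trans (congrArg (fun ψ : CharDual R F => ψ x) hφ)
    refine hχ (h.symm.trans (Finset.sum_eq_zero fun k _ => ?_))
    rw [← charLift_balMk (S := S), ← coevMap_toHom, hx]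
    exact map_zero _
  · intro g
    -- A homomorphism from C is determined by its values on the generators, and it lies in the image
    -- of coevaluation exactly when that tuple lies in `H`. Otherwise a character `χ` vanishing on
    -- `H` detects it.
    let H : AddSubgroup (Fin P.n → BalTensor S R C F) :=
      (AddMonoidHom.mk' (fun (x : F) k => balMk S R (P.gen k) x) fun x x' =>
        funext fun k => balMk_add_right _ _ _).range
    by_cases ht : (fun k => g.toHom (P.gen k)) ∈ H
    · obtain ⟨x, hx⟩ := ht
      exact ⟨x, P.hom_ext fun k => congrFun hx k⟩
    · exfalso
      obtain ⟨χ, hχ, hne⟩ := exists_character_of_notMem H ht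
      let χ' (k : Fin P.n) : BalTensor S R C F →+ AddCircle (1 : ℚ) :=
        AddMonoidHom.comp χ (AddMonoidHom.single (fun _ => BalTensor S R C F) k)
      have hχ' (t : Fin P.n → BalTensor S R C F) : ∑ k, χ' k (t k) = χ t :=
        addMonoidHom_sum_map_single (χ : _ →+ AddCircle (1 : ℚ)) t
      -- Vanishing on `H` makes `χ` factor through the relations of C, which the tuple of values of
      -- the S-linear `g` satisfies; hence `χ` kills that tuple.
      obtain ⟨ψ, hψ⟩ := h₂ (fun k => charCurry (χ' k)) (CharDual.ext fun x => by
        rw [CharDual.sum_apply]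
        exact (hχ' fun k => balMk S R (P.gen k) x).trans (hχ _ ⟨x, rfl⟩))
      have hsum (k : Fin P.n) (t : BalTensor S R C F) :
          χ' k t = ∑ j, charLift S (ψ j) (P.rel j k • t) := by
        induction t using balTensor_induction with
        | zero => simp
        | mk c x =>
          have := congrArg (fun ψ : CharDual R F => ψ x) (hψ k c)
          exact this.trans (CharDual.sum_apply _ _ _)
        | add t t' h h' => simp only [map_add, smul_add, h, h', Finset.sum_add_distrib]
      refine hne ((hχ' _).symm.trans ?_)
      simp only [hsum]
      rw [Finset.sum_comm]
      refine Finset.sum_eq_zero fun j _ => ?_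
      rw [← map_sum]
      simp only [← map_smul]
      rw [← map_sum, P.rel_gen, map_zero, map_zero]

/-- If M ≅ Hom_S(C, I), then C ⊗_R M ≅ I by evaluation, and a triangle identity writes the given
isomorphism as Hom_S(C, θ) after coevaluation, forcing the latter to be bijective. -/
theorem wic_iff (hC : Semidualizing S R C) (M : ModuleCat.{u} R) :
    WIC S R C M ↔ WeakInjective S (ModuleCat.of S (BalTensor S R C M)) ∧
      Function.Bijective (coevMap S R C M) := by
  constructor
  · rintro ⟨I, hI, ⟨e⟩⟩
    let θ := evalMap S R C I ∘ₗ balMapRight S C e.toLinearMap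
    have hθ : Function.Bijective θ := (bijective_evalMap hC hI).comp (bijective_balMapRight e)
    refine ⟨(weakInjective_matrixDefinable S).of_equiv (LinearEquiv.ofBijective θ hθ).symm hI, ?_⟩
    refine ((bijective_bimodMap (R := R) (C := C) hθ).of_comp_iff' _).1 ?_
    have : bimodMap R C θ ∘ coevMap S R C M = e := funext fun x => BimodHom.ext fun c => rfl
    rw [this]
    exact e.bijective
  · rintro ⟨h, h'⟩
    exact ⟨_, h, ⟨LinearEquiv.ofBijective _ h'⟩⟩

/-- Dual to `wic_iff`: coevaluation identifies F with Hom_S(C, V), and the other triangle identity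
applies. -/
theorem wfc_iff (hC : Semidualizing S R C) (V : ModuleCat.{u} S) :
    WFC S R C V ↔ WeakFlat R (ModuleCat.of R (BimodHom S C V R)) ∧
      Function.Bijective (evalMap S R C V) := by
  constructor
  · rintro ⟨F, hF, ⟨e⟩⟩
    let θ := bimodMap R C e.symm.toLinearMap ∘ₗ coevMap S R C F
    have hθ : Function.Bijective θ :=
      (bijective_bimodMap e.symm.bijective).comp (bijective_coevMap hC hF)
    refine ⟨(weakFlat_matrixDefinable R).of_equiv (LinearEquiv.ofBijective θ hθ) hF, ?_⟩
    refine (Function.Bijective.of_comp_iff _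
      (bijective_balMapRight (S := S) (C := C) (LinearEquiv.ofBijective θ hθ))).1 ?_
    have : evalMap S R C V ∘ₗ balMapRight S C (LinearEquiv.ofBijective θ hθ).toLinearMap =
        e.symm.toLinearMap := balTensor_linearMap_ext fun c x => rfl
    rw [← LinearMap.coe_comp, this]
    exact e.symm.bijective
  · rintro ⟨h, h'⟩
    exact ⟨_, h, ⟨(LinearEquiv.ofBijective _ h').symm⟩⟩

end Bijective

/-- A retract of a bijective map is bijective. -/
theorem bijective_of_retract {X Y X' Y' : Type*} {f : X → Y} {f' : X' → Y'} (i : X → X')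
    (r : X' → X) (i' : Y → Y') (r' : Y' → Y) (hr : ∀ x, r (i x) = x) (hr' : ∀ y, r' (i' y) = y)
    (hi : ∀ x, i' (f x) = f' (i x)) (hf : ∀ x, f (r x) = r' (f' x)) (h : Function.Bijective f') :
    Function.Bijective f := by
  constructor
  · intro x y hxy
    rw [← hr x, ← hr y]
    exact congrArg r (h.1 (by rw [← hi, ← hi, hxy]))
  · intro y
    obtain ⟨x, hx⟩ := h.2 (i' y)
    exact ⟨r x, by rw [hf, hx, hr']⟩

/-! ### Closure under direct summands and direct products -/

section

variable {S R : Type u} [Ring S] [Ring R]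
variable {C : Type u} [AddCommGroup C] [Module S C] [Module Rᵐᵒᵖ C] [SMulCommClass S Rᵐᵒᵖ C]

theorem wic_closedUnderSummands (hC : Semidualizing S R C) : ClosedUnderSummands (WIC S R C) := by
  rintro M X Y ⟨e⟩ hM
  obtain ⟨h, h'⟩ := (wic_iff hC M).1 hM
  let i : X →ₗ[R] M := e.symm.toLinearMap ∘ₗ LinearMap.inl R X Y
  let r : M →ₗ[R] X := LinearMap.fst R X Y ∘ₗ e.toLinearMap
  have hr : r ∘ₗ i = LinearMap.id := by
    ext x
    simp [i, r]
  have hr' (t : BalTensor S R C X) : balMapRight S C r (balMapRight S C i t) = t := by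
    rw [balMapRight_comp, hr, balMapRight_id]
  refine (wic_iff hC X).2 ⟨(weakInjective_matrixDefinable S).of_retract (balMapRight S C i)
    (balMapRight S C r) hr' h, ?_⟩
  exact bijective_of_retract i r (bimodMap R C (balMapRight S C i))
    (bimodMap R C (balMapRight S C r)) (LinearMap.congr_fun hr)
    (fun φ => BimodHom.ext fun c => hr' _) (fun x => (coevMap_naturality i x).symm)
    (fun x => coevMap_naturality r x) h'

theorem wfc_closedUnderSummands (hC : Semidualizing S R C) : ClosedUnderSummands (WFC S R C) := by
  rintro V X Y ⟨e⟩ hV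
  obtain ⟨h, h'⟩ := (wfc_iff hC V).1 hV
  let i : X →ₗ[S] V := e.symm.toLinearMap ∘ₗ LinearMap.inl S X Y
  let r : V →ₗ[S] X := LinearMap.fst S X Y ∘ₗ e.toLinearMap
  have hr : r ∘ₗ i = LinearMap.id := by
    ext x
    simp [i, r]
  have hr' (φ : BimodHom S C X R) : bimodMap R C r (bimodMap R C i φ) = φ :=
    BimodHom.ext fun c => LinearMap.congr_fun hr _
  refine (wfc_iff hC X).2 ⟨(weakFlat_matrixDefinable R).of_retract (bimodMap R C i)
    (bimodMap R C r) hr' h, ?_⟩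
  refine bijective_of_retract (balMapRight S C (bimodMap R C i))
    (balMapRight S C (bimodMap R C r)) i r (fun t => ?_) (LinearMap.congr_fun hr)
    (fun t => (evalMap_naturality i t).symm) (fun t => evalMap_naturality r t) h'
  rw [balMapRight_comp]
  have : bimodMap R C r ∘ₗ bimodMap R C i = LinearMap.id := LinearMap.ext hr'
  rw [this, balMapRight_id]

theorem wic_closedUnderProducts : ClosedUnderProducts (WIC S R C) := by
  intro ι M hM
  choose I hI e using hM
  replace e := fun i => (e i).some
  refine ⟨ModuleCat.of S (∀ i, I i),
    (weakInjective_matrixDefinable S).closedUnderProducts ι I hI, ⟨LinearEquiv.symm ?_⟩⟩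
  let f : BimodHom S C (∀ i, I i) R →ₗ[R] ∀ i, M i :=
    LinearMap.pi fun i => (e i).symm.toLinearMap ∘ₗ bimodMap R C (LinearMap.proj i)
  refine LinearEquiv.ofBijective f ⟨fun φ ψ h => BimodHom.ext fun c => funext fun i => ?_,
    fun m => ⟨BimodHom.ofHom (LinearMap.pi fun i => (e i (m i)).toHom), funext fun i => ?_⟩⟩
  · exact congrArg (fun χ : BimodHom S C (I i) R => χ.toHom c)
      ((e i).symm.injective (congrFun h i))
  · exact (e i).symm_apply_apply (m i)

/-- The kernel of `F ⊕ ⋯ ⊕ F → C ⊗_R F` for a finitely presented right module `C`. -/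
theorem FinPresentation.exists_of_sum_balMk_eq_zero (P : FinPresentation Rᵐᵒᵖ C) {F : Type u}
    [AddCommGroup F] [Module R F] (x : Fin P.n → F)
    (hx : ∑ k, balMk S R (P.gen k) (x k) = 0) :
    ∃ y : Fin P.m → F, ∀ k, x k = ∑ j, (P.rel j k).unop • y j := by
  let H : AddSubgroup (Fin P.n → F) :=
    (AddMonoidHom.mk' (fun (y : Fin P.m → F) k => ∑ j, (P.rel j k).unop • y j) fun y y' =>
      funext fun k => by simp [Finset.sum_add_distrib]).range
  by_cases h : x ∈ H
  · obtain ⟨y, hy⟩ := h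
    exact ⟨y, fun k => (congrFun hy k).symm⟩
  -- A character separating `x` from the relations defines, through the presentation, a map from C
  -- to the characters of F, hence a character of C ⊗_R F that is nonzero on the vanishing sum.
  · exfalso
    obtain ⟨χ, hχ, hne⟩ := exists_character_of_notMem H h
    let χ' (k : Fin P.n) : CharDual R F :=
      AddMonoidHom.comp χ (AddMonoidHom.single (fun _ => F) k)
    have hχ' (z : Fin P.n → F) : ∑ k, χ' k (z k) = χ z :=
      addMonoidHom_sum_map_single (χ : _ →+ AddCircle (1 : ℚ)) z
    obtain ⟨φ, hφ⟩ := P.exists_hom χ' fun j => CharDual.ext fun v => by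
      rw [CharDual.sum_apply]
      refine (hχ' fun k => (P.rel j k).unop • v).trans (hχ _ ⟨Pi.single j v, funext fun k => ?_⟩)
      refine (Finset.sum_eq_single j (fun l _ hl => ?_)
        fun h => absurd (Finset.mem_univ j) h).trans ?_
      · rw [Pi.single_eq_of_ne hl, smul_zero]
      · rw [Pi.single_eq_same]
    refine hne ?_
    rw [← hχ', ← map_zero (charLift S φ), ← hx, map_sum]
    exact Finset.sum_congr rfl fun k _ => by rw [charLift_balMk, hφ]

/-- Tensoring with a finitely presented module commutes with products: finitely many generators give
surjectivity, finitely many relations injectivity. -/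
theorem wfc_closedUnderProducts (hC : Semidualizing S R C) : ClosedUnderProducts (WFC S R C) := by
  intro ι V hV
  obtain ⟨P⟩ := hC.a2.nonempty_finPresentation
  choose F hF e using hV
  replace e := fun i => (e i).some
  refine ⟨ModuleCat.of R (∀ i, F i),
    (weakFlat_matrixDefinable R).closedUnderProducts ι F hF, ⟨LinearEquiv.symm ?_⟩⟩
  have hspan (y : C) : ∃ r : Fin P.n → R, ∑ k, op (r k) • P.gen k = y :=
    have ⟨a, ha⟩ := P.exists_sum_gen y; ⟨fun k => (a k).unop, ha⟩
  let f : BalTensor S R C (∀ i, F i) →ₗ[S] ∀ i, V i :=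
    LinearMap.pi fun i => (e i).symm.toLinearMap ∘ₗ balMapRight S C (LinearMap.proj i)
  have hf (x : Fin P.n → ∀ i, F i) (i : ι) : f (∑ k, balMk S R (P.gen k) (x k)) i =
      (e i).symm (∑ k, balMk S R (P.gen k) (x k i)) := by
    rw [map_sum, Finset.sum_apply, map_sum]
    rfl
  refine LinearEquiv.ofBijective f ⟨(injective_iff_map_eq_zero _).2 fun t ht => ?_, fun v => ?_⟩
  · obtain ⟨x, rfl⟩ := exists_sum_balMk_eq (S := S) P.gen hspan t
    choose y hy using fun i => P.exists_of_sum_balMk_eq_zero (S := S) (fun k => x k i) (by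
      rw [← (e i).symm.map_eq_zero_iff, ← hf, ht]
      rfl)
    have hx (k : Fin P.n) : x k = ∑ j, (P.rel j k).unop • fun i => y i j :=
      funext fun i => (hy i k).trans (by simp)
    simp only [hx, balMk_sum_right, ← balMk_op_smul, op_unop]
    rw [Finset.sum_comm]
    refine Finset.sum_eq_zero fun j _ => ?_
    rw [← balMk_sum_left, P.rel_gen, balMk_zero_left]
  · choose x hx using fun i => exists_sum_balMk_eq (S := S) P.gen hspan (e i (v i))
    refine ⟨∑ k, balMk S R (P.gen k) fun i => x i k, funext fun i => ?_⟩
    rw [hf, hx, LinearEquiv.symm_apply_apply]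

/-! ### Closure under direct sums -/

section DirectSum

variable {ι : Type u} [DecidableEq ι]

/-- The map from the direct sum of the `M i` to `Hom_S(C, ⨁ I i)` induced by maps from `M i` to
`Hom_S(C, I i)`. -/
def directSumToHom {M I : ι → Type u} [∀ i, AddCommGroup (M i)] [∀ i, Module R (M i)]
    [∀ i, AddCommGroup (I i)] [∀ i, Module S (I i)] (e : ∀ i, M i →ₗ[R] BimodHom S C (I i) R) :
    (⨁ i, M i) →ₗ[R] BimodHom S C (⨁ i, I i) R :=
  DirectSum.toModule R ι _ fun i => bimodMap R C (DirectSum.lof S ι I i) ∘ₗ e i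

theorem directSumToHom_lof {M I : ι → Type u} [∀ i, AddCommGroup (M i)] [∀ i, Module R (M i)]
    [∀ i, AddCommGroup (I i)] [∀ i, Module S (I i)] (e : ∀ i, M i →ₗ[R] BimodHom S C (I i) R)
    (i : ι) (x : M i) :
    directSumToHom e (DirectSum.lof R ι M i x) = bimodMap R C (DirectSum.lof S ι I i) (e i x) :=
  DirectSum.toModule_lof R i x

theorem directSumToHom_apply {M I : ι → Type u} [∀ i, AddCommGroup (M i)] [∀ i, Module R (M i)]
    [∀ i, AddCommGroup (I i)] [∀ i, Module S (I i)] (e : ∀ i, M i →ₗ[R] BimodHom S C (I i) R)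
    (z : ⨁ i, M i) (c : C) (i : ι) :
    (directSumToHom e z).toHom c i = (e i (z i)).toHom c := by
  have : LinearMap.toAddMonoidHom (bimodMap R C (DirectSum.component S ι I i) ∘ₗ directSumToHom e) =
      LinearMap.toAddMonoidHom (e i ∘ₗ DirectSum.component R ι M i) := by
    congr 1
    refine DirectSum.linearMap_ext R fun j => LinearMap.ext fun x => ?_
    change bimodMap R C (DirectSum.component S ι I i)
      (directSumToHom e (DirectSum.lof R ι M j x)) = e i (DirectSum.lof R ι M j x i)
    rw [directSumToHom_lof]
    refine BimodHom.ext fun c => ?_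
    change DirectSum.lof S ι I j ((e j x).toHom c) i = _
    by_cases h : j = i
    · subst h
      rw [DirectSum.lof_apply, DirectSum.lof_apply]
    · rw [DirectSum.lof_eq_of, DirectSum.lof_eq_of, DirectSum.of_eq_of_ne _ _ _ (Ne.symm h),
        DirectSum.of_eq_of_ne _ _ _ (Ne.symm h), map_zero]
      rfl
  exact congrArg (fun φ : BimodHom S C (I i) R => φ.toHom c) (DFunLike.congr_fun this z)

/-- A map from the finitely generated module C to a direct sum meets only finitely many summands. -/
theorem bijective_directSumToHom (P : FinPresentation S C) {M I : ι → Type u}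
    [∀ i, AddCommGroup (M i)] [∀ i, Module R (M i)] [∀ i, AddCommGroup (I i)]
    [∀ i, Module S (I i)] (e : ∀ i, M i ≃ₗ[R] BimodHom S C (I i) R) :
    Function.Bijective (directSumToHom fun i => (e i).toLinearMap) := by
  classical
  refine ⟨(injective_iff_map_eq_zero _).2 fun z hz => ?_, fun g => ?_⟩
  · refine DFinsupp.ext fun i => (e i).map_eq_zero_iff.1 (BimodHom.ext fun c => ?_)
    refine (directSumToHom_apply (fun i => (e i).toLinearMap) z c i).symm.trans ?_
    rw [hz]
    rfl
  · let s : Finset ι := Finset.univ.biUnion fun k =>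
      DFinsupp.support (β := I) (g.toHom (P.gen k))
    let y (i : ι) : M i := (e i).symm (BimodHom.ofHom (DirectSum.component S ι I i ∘ₗ g.toHom))
    let z : ⨁ i, M i := DirectSum.mk M s fun i => y i
    refine ⟨z, P.hom_ext (g := g.toHom) fun k => DFinsupp.ext fun i => ?_⟩
    refine (directSumToHom_apply (fun i => (e i).toLinearMap) z (P.gen k) i).trans ?_
    by_cases hi : i ∈ s
    · have hz : z i = y i := DirectSum.mk_apply_of_mem hi
      rw [hz]
      exact congrArg (fun φ : BimodHom S C (I i) R => φ.toHom (P.gen k))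
        ((e i).apply_symm_apply _)
    · have hz : z i = 0 := DirectSum.mk_apply_of_notMem hi
      rw [hz, map_zero]
      by_contra h
      exact hi (Finset.mem_biUnion.2 ⟨k, Finset.mem_univ _,
        DFinsupp.mem_support_iff.2 (Ne.symm h)⟩)

/-- The tensor product commutes with direct sums. -/
def directSumEquivBalTensor {V F : ι → Type u} [∀ i, AddCommGroup (V i)] [∀ i, Module S (V i)]
    [∀ i, AddCommGroup (F i)] [∀ i, Module R (F i)] (e : ∀ i, V i ≃ₗ[S] BalTensor S R C (F i)) :
    (⨁ i, V i) ≃ₗ[S] BalTensor S R C (⨁ i, F i) :=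
  have hf (i : ι) (v : V i) : DirectSum.toModule S ι (BalTensor S R C (⨁ i, F i))
      (fun i => balMapRight S C (DirectSum.lof R ι F i) ∘ₗ (e i).toLinearMap)
      (DirectSum.lof S ι V i v) = balMapRight S C (DirectSum.lof R ι F i) (e i v) :=
    DirectSum.toModule_lof S i v
  have hg (i : ι) (c : C) (x : F i) : (evalMap S R C (⨁ i, V i) ∘ₗ balMapRight S C
      (directSumToHom fun i => bimodMap R C (e i).symm.toLinearMap ∘ₗ coevMap S R C (F i)))
        (balMk S R c (DirectSum.lof R ι F i x)) =
      DirectSum.lof S ι V i ((e i).symm (balMk S R c x)) := by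
    rw [LinearMap.comp_apply, balMapRight_balMk, directSumToHom_lof]
    rfl
  LinearEquiv.ofLinearMap
    (DirectSum.toModule S ι _ fun i =>
      balMapRight S C (DirectSum.lof R ι F i) ∘ₗ (e i).toLinearMap)
    -- The inverse is the adjoint of the map from the sum of the F i to Hom_S(C, ⨁ V i).
    (evalMap S R C (⨁ i, V i) ∘ₗ balMapRight S C
      (directSumToHom fun i => bimodMap R C (e i).symm.toLinearMap ∘ₗ coevMap S R C (F i)))
    (by
      refine balTensor_linearMap_ext fun c z => ?_
      induction z using DirectSum.induction_on with
      | zero => rw [balMk_zero_right, map_zero, map_zero]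
      | of i x =>
        rw [LinearMap.comp_apply, ← DirectSum.lof_eq_of R, hg, hf, LinearEquiv.apply_symm_apply]
        rfl
      | add z z' h h' => rw [balMk_add_right, map_add, map_add, h, h'])
    (by
      refine DirectSum.linearMap_ext S fun i => LinearMap.ext fun v => ?_
      obtain ⟨t, rfl⟩ := (e i).symm.surjective v
      rw [LinearMap.comp_apply, LinearMap.comp_apply, hf, LinearEquiv.apply_symm_apply]
      induction t using balTensor_induction with
      | zero => simp
      | mk c x => exact hg i c x
      | add t t' h h' => simp only [map_add, h, h'])

end DirectSum

theorem wic_closedUnderDirectSums (hC : Semidualizing S R C) :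
    ClosedUnderDirectSums (WIC S R C) := by
  classical
  intro ι M hM
  obtain ⟨P⟩ := hC.a1.nonempty_finPresentation
  choose I hI e using hM
  exact ⟨ModuleCat.of S (⨁ i, I i),
    (weakInjective_matrixDefinable S).closedUnderDirectSums ι I hI,
    ⟨LinearEquiv.ofBijective _ (bijective_directSumToHom P fun i => (e i).some)⟩⟩

theorem wfc_closedUnderDirectSums : ClosedUnderDirectSums (WFC S R C) := by
  classical
  intro ι V hV
  choose F hF e using hV
  exact ⟨ModuleCat.of R (⨁ i, F i),
    (weakFlat_matrixDefinable R).closedUnderDirectSums ι F hF,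
    ⟨directSumEquivBalTensor fun i => (e i).some⟩⟩

/-! ### Closure under direct limits -/

/-- The images of the generators lift to a common stage, and the finitely many relations hold at a
later one. -/
theorem FinPresentation.exists_factor_directLimit {A : Type*} [Ring A] {D : Type*}
    [AddCommGroup D] [Module A D] (P : FinPresentation A D) {ι : Type*} [Preorder ι]
    [DecidableEq ι] [Nonempty ι] [IsDirectedOrder ι] {N : ι → Type*} [∀ i, AddCommGroup (N i)]
    [∀ i, Module A (N i)] {f : ∀ i j, i ≤ j → N i →ₗ[A] N j}
    [DirectedSystem N fun i j h => f i j h] (g : D →ₗ[A] Module.DirectLimit N f) :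
    ∃ (i : ι) (g' : D →ₗ[A] N i), Module.DirectLimit.of A ι N f i ∘ₗ g' = g := by
  obtain ⟨i, x, hx⟩ := directLimit_exists_lift fun k => g (P.gen k)
  obtain ⟨j, hij, hj⟩ := directLimit_exists_map_eq_zero (f := f)
    (fun l => ∑ k, P.rel l k • x k) fun l => by
      simp only [map_sum, map_smul, hx]
      simp only [← map_smul]
      rw [← map_sum, P.rel_gen, map_zero]
  obtain ⟨g', hg'⟩ := P.exists_hom (fun k => f i j hij (x k)) fun l => by
    simpa only [map_sum, map_smul] using hj l
  refine ⟨j, g', P.hom_ext fun k => ?_⟩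
  rw [LinearMap.comp_apply, hg', Module.DirectLimit.of_f, hx]

/-- The modules C ⊗_R M i form a direct system of weak injectives. Its limit is the required module,
because Hom_S(C, -) commutes with direct limits for finitely presented C and each coevaluation is
bijective. -/
theorem wic_closedUnderDirectLimits (hC : Semidualizing S R C) :
    ClosedUnderDirectLimits (WIC S R C) := by
  classical
  intro ι _ _ _ M f _ hM
  obtain ⟨P⟩ := hC.a1.nonempty_finPresentation
  have hM' := fun i => (wic_iff hC (M i)).1 (hM i)
  let F : ∀ i j, i ≤ j → BalTensor S R C (M i) →ₗ[S] BalTensor S R C (M j) :=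
    fun i j h => balMapRight S C (f i j h)
  have : DirectedSystem (fun i => BalTensor S R C (M i)) fun i j h => F i j h :=
    { map_self := fun i t => by
        have h : f i i le_rfl = LinearMap.id :=
          LinearMap.ext fun x => DirectedSystem.map_self' f x
        exact (congrArg (fun k => balMapRight S C k t) h).trans (balMapRight_id t)
      map_map := fun k j i hij hjk t => by
        have h : f j k hjk ∘ₗ f i j hij = f i k (hij.trans hjk) :=
          LinearMap.ext fun x => DirectedSystem.map_map' f hij hjk x
        exact (balMapRight_comp _ _ t).trans (congrArg (fun k => balMapRight S C k t) h) }
  have hlim := (weakInjective_matrixDefinable S).closedUnderDirectLimits ι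
    (fun i => ModuleCat.of S (BalTensor S R C (M i))) F fun i => (hM' i).1
  refine ⟨_, hlim, ⟨?_⟩⟩
  let L := Module.DirectLimit (fun i => BalTensor S R C (M i)) F
  let o (i : ι) : BalTensor S R C (M i) →ₗ[S] L := Module.DirectLimit.of S ι _ F i
  let g : Module.DirectLimit (fun i => M i) f →ₗ[R] BimodHom S C L R :=
    Module.DirectLimit.lift R ι _ f (fun i => bimodMap R C (o i) ∘ₗ coevMap S R C (M i))
      fun i j hij x => BimodHom.ext fun c =>
        (Module.DirectLimit.of_f (f := F) (hij := hij) (x := balMk S R c x))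
  have hg (i : ι) (x : M i) : g (Module.DirectLimit.of R ι (fun i => M i) f i x) =
      bimodMap R C (o i) (coevMap S R C (M i) x) := Module.DirectLimit.lift_of _ _ _
  refine LinearEquiv.ofBijective g ⟨(injective_iff_map_eq_zero _).2 fun z hz => ?_, fun φ => ?_⟩
  · obtain ⟨i, x, rfl⟩ := Module.DirectLimit.exists_of z
    rw [hg] at hz
    obtain ⟨j, hij, hj⟩ := directLimit_exists_map_eq_zero (f := F)
      (fun k => balMk S R (P.gen k) x) fun k =>
        congrArg (fun φ : BimodHom S C L R => φ.toHom (P.gen k)) hz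
    have hx : f i j hij x = 0 := by
      refine (hM' j).2.1 ?_
      rw [map_zero]
      exact P.hom_ext (f := (coevMap S R C (M j) (f i j hij x)).toHom) (g := 0) hj
    rw [← Module.DirectLimit.of_f (hij := hij), hx, map_zero]
  · obtain ⟨i, φ', hφ⟩ := P.exists_factor_directLimit φ.toHom
    obtain ⟨x, hx⟩ := (hM' i).2.2 (BimodHom.ofHom φ')
    refine ⟨Module.DirectLimit.of R ι (fun i => M i) f i x, ?_⟩
    rw [hg, hx]
    exact hφ

/-- Here the limit of the weak flat modules Hom_S(C, V i) is used. The map `a` comes from the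
inverse evaluations at each stage, and its inverse `b` is adjoint to the comparison map `k`. -/
theorem wfc_closedUnderDirectLimits (hC : Semidualizing S R C) :
    ClosedUnderDirectLimits (WFC S R C) := by
  classical
  intro ι _ _ _ V f _ hV
  have hV' := fun i => (wfc_iff hC (V i)).1 (hV i)
  let F : ∀ i j, i ≤ j → BimodHom S C (V i) R →ₗ[R] BimodHom S C (V j) R :=
    fun i j h => bimodMap R C (f i j h)
  have : DirectedSystem (fun i => BimodHom S C (V i) R) fun i j h => F i j h :=
    { map_self := fun i φ => BimodHom.ext fun c => DirectedSystem.map_self' f (φ.toHom c)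
      map_map := fun k j i hij hjk φ => BimodHom.ext fun c =>
        DirectedSystem.map_map' f hij hjk (φ.toHom c) }
  have hlim := (weakFlat_matrixDefinable R).closedUnderDirectLimits ι
    (fun i => ModuleCat.of R (BimodHom S C (V i) R)) F fun i => (hV' i).1
  refine ⟨_, hlim, ⟨?_⟩⟩
  let L := Module.DirectLimit (fun i => BimodHom S C (V i) R) F
  let o (i : ι) : BimodHom S C (V i) R →ₗ[R] L := Module.DirectLimit.of R ι _ F i
  let o' (i : ι) : V i →ₗ[S] Module.DirectLimit (fun i => V i) f :=
    Module.DirectLimit.of S ι _ f i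
  let e (i : ι) : BalTensor S R C (BimodHom S C (V i) R) ≃ₗ[S] V i :=
    LinearEquiv.ofBijective _ (hV' i).2
  have he (i j : ι) (hij : i ≤ j) (v : V i) :
      (e j).symm (f i j hij v) = balMapRight S C (F i j hij) ((e i).symm v) := by
    rw [LinearEquiv.symm_apply_eq]
    exact (congrArg _ ((e i).apply_symm_apply v).symm).trans (evalMap_naturality _ _).symm
  have ho (i j : ι) (hij : i ≤ j) : o j ∘ₗ F i j hij = o i :=
    LinearMap.ext fun φ => Module.DirectLimit.of_f
  let k : L →ₗ[R] BimodHom S C (Module.DirectLimit (fun i => V i) f) R :=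
    Module.DirectLimit.lift R ι _ F (fun i => bimodMap R C (o' i))
      fun i j hij φ => BimodHom.ext fun c => Module.DirectLimit.of_f
  have hk (i : ι) (φ : BimodHom S C (V i) R) : k (o i φ) = bimodMap R C (o' i) φ :=
    Module.DirectLimit.lift_of _ _ _
  let a : Module.DirectLimit (fun i => V i) f →ₗ[S] BalTensor S R C L :=
    Module.DirectLimit.lift S ι _ f
      (fun i => balMapRight S C (o i) ∘ₗ (e i).symm.toLinearMap) fun i j hij v => by
        change balMapRight S C (o j) ((e j).symm (f i j hij v)) =
          balMapRight S C (o i) ((e i).symm v)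
        rw [he, balMapRight_comp, ho]
  have ha (i : ι) (v : V i) : a (o' i v) = balMapRight S C (o i) ((e i).symm v) :=
    Module.DirectLimit.lift_of _ _ _
  let b : BalTensor S R C L →ₗ[S] Module.DirectLimit (fun i => V i) f :=
    evalMap S R C _ ∘ₗ balMapRight S C k
  refine LinearEquiv.ofLinearMap a b ?_ ?_
  · refine balTensor_linearMap_ext fun c z => ?_
    obtain ⟨i, φ, rfl⟩ := Module.DirectLimit.exists_of z
    change a ((k (o i φ)).toHom c) = balMk S R c (o i φ)
    rw [hk, bimodMap_toHom, ha]
    have : (e i).symm (φ.toHom c) = balMk S R c φ := (e i).symm_apply_eq.2 rfl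
    rw [this, balMapRight_balMk]
  · refine LinearMap.ext fun z => ?_
    obtain ⟨i, v, rfl⟩ := Module.DirectLimit.exists_of z
    change b (a (o' i v)) = o' i v
    rw [ha]
    change evalMap S R C _ (balMapRight S C k (balMapRight S C (o i) ((e i).symm v))) = _
    have : k ∘ₗ o i = bimodMap R C (o' i) := LinearMap.ext (hk i)
    rw [balMapRight_comp, this, evalMap_naturality]
    exact congrArg (o' i) ((e i).apply_symm_apply v)

end

end

end CWeak

theorem proposition2p8 (R S : Type u) [Ring R] [Ring S]
    (C : Type u) [AddCommGroup C] [Module S C] [Module Rᵐᵒᵖ C] [SMulCommClass S Rᵐᵒᵖ C]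
    (hC : CWeak.FaithfullySemidualizing S R C) :
    (CWeak.ClosedUnderSummands (CWeak.WFC S R C) ∧
      CWeak.ClosedUnderProducts (CWeak.WFC S R C) ∧
      CWeak.ClosedUnderDirectSums (CWeak.WFC S R C) ∧
      CWeak.ClosedUnderDirectLimits (CWeak.WFC S R C)) ∧
    (CWeak.ClosedUnderSummands (CWeak.WIC S R C) ∧
      CWeak.ClosedUnderProducts (CWeak.WIC S R C) ∧
      CWeak.ClosedUnderDirectSums (CWeak.WIC S R C) ∧
      CWeak.ClosedUnderDirectLimits (CWeak.WIC S R C)) := by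
  have h := hC.toSemidualizing
  exact ⟨⟨CWeak.wfc_closedUnderSummands h, CWeak.wfc_closedUnderProducts h,
      CWeak.wfc_closedUnderDirectSums, CWeak.wfc_closedUnderDirectLimits h⟩,
    CWeak.wic_closedUnderSummands h, CWeak.wic_closedUnderProducts,
    CWeak.wic_closedUnderDirectSums h, CWeak.wic_closedUnderDirectLimits h⟩
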